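/- All graphs are finite and simple, and isomorphic graphs are not distinguished. (A 3-connected cubic graph never has parallel edges.) A graph is cubic if every vertex has degree 3, and 3-connected if it has more than three vertices and stays connected after the deletion of any fewer than three vertices. An edge of a graph is called lonely if it belongs to exactly one perfect matching of the graph. Let $\mathcal{U}$ be the class of all 3-connected cubic graphs that have at least one lonely edge. For a cubic graph $G$ and a vertex $v$ of $G$ with neighbours $x_1,x_2,x_3$, let $G^v$ be the graph obtained from $G$ by replacing $v$ with a triangle, that is, with new vertices $v_1,v_2,v_3$, $$V(G^v)=(V(G)\setminus\{v\})\cup\{v_1,v_2,v_3\},$$ $$E(G^v)=(E(G)\setminus\{vx_1,vx_2,vx_3\})\cup\{v_1x_1,v_2x_2,v_3x_3\}\cup\{v_1v_2,v_2v_3,v_3v_1\}.$$ A $v$-join of $G$ is a spanning subgraph of $G$ in which $v$ has degree 3 and every other vertex has degree 1. Proposition. The class $\mathcal{U}$ is defined inductively by the following two rules, i.e. it is the smallest class of graphs satisfying both: (i) $K_4\in\mathcal{U}$; (ii) if $G\in\mathcal{U}$, $e\in E(G)$ is a lonely edge of $G$, and $v\in V(G)$ is either incident with $e$ or such that no $v$-join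 of $G$ contains $e$, then $G^v\in\mathcal{U}$. In particular, $\mathcal{U}$ satisfies (i) and (ii), and every member of $\mathcal{U}$ is obtained from $K_4$ by finitely many applications of (ii). -/

import Mathlib

universe u

namespace CubicGraph

/-- Every vertex has exactly three neighbours. -/
def IsCubic {V : Type u} (G : SimpleGraph V) : Prop :=
  ∀ v : V, (G.neighborSet v).ncard = 3

/-- A finite graph with more than three vertices that stays connected after the deletion of any
set of fewer than three vertices. -/
def IsThreeConnected {V : Type u} (G : SimpleGraph V) : Prop :=
  Finite V ∧ 3 < Nat.card V ∧ ∀ S : Set V, S.ncard < 3 → (G.induce Sᶜ).Connected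

/-- An edge of `G` that belongs to exactly one perfect matching of `G`. -/
def IsLonely {V : Type u} (G : SimpleGraph V) (e : Sym2 V) : Prop :=
  e ∈ G.edgeSet ∧ ∃! M : G.Subgraph, M.IsPerfectMatching ∧ e ∈ M.edgeSet

/-- A spanning subgraph in which `v` has degree 3 and every other vertex has degree 1. -/
def IsJoin {V : Type u} {G : SimpleGraph V} (v : V) (J : G.Subgraph) : Prop :=
  J.IsSpanning ∧ (J.neighborSet v).ncard = 3 ∧ ∀ w : V, w ≠ v → (J.neighborSet w).ncard = 1

/-- The class of 3-connected cubic graphs having a lonely edge. -/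
def InU {V : Type u} (G : SimpleGraph V) : Prop :=
  IsCubic G ∧ IsThreeConnected G ∧ ∃ e : Sym2 V, IsLonely G e

/-- The graph obtained from `G` by replacing the vertex `v` with a triangle. Its vertices are the
vertices of `G` other than `v`, and one new vertex `Sum.inr x` for every neighbour `x` of `v`. The
new vertices are pairwise adjacent, and the new vertex of `x` is adjacent to `x`. -/
def replaceByTriangle {V : Type u} (G : SimpleGraph V) (v : V) :
    SimpleGraph ({w : V // w ≠ v} ⊕ {x : V // G.Adj v x}) where
  Adj
    | Sum.inl a, Sum.inl b => G.Adj a.1 b.1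
    | Sum.inl a, Sum.inr x => a.1 = x.1
    | Sum.inr x, Sum.inl a => a.1 = x.1
    | Sum.inr x, Sum.inr y => x ≠ y
  symm := ⟨by
    rintro (a | x) (b | y) h
    · exact SimpleGraph.Adj.symm h
    · exact h
    · exact h
    · exact Ne.symm h⟩
  loopless := ⟨by
    rintro (a | x) h
    · exact G.loopless.irrefl _ h
    · exact h rfl⟩

/-- The smallest class of graphs, with isomorphic graphs not distinguished, that contains the
complete graph on four vertices and that contains, with `G`, the graph obtained by replacing `v`
with a triangle whenever `G` has a lonely edge `e` that is incident with `v` or is contained in no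
`v`-join of `G`. -/
inductive Generated : ∀ {V : Type u}, SimpleGraph V → Prop
  | base {V : Type u} (G : SimpleGraph V)
      (iso : Nonempty (G ≃g (⊤ : SimpleGraph (Fin 4)))) : Generated G
  | step {V W : Type u} (G : SimpleGraph V) (e : Sym2 V) (v : V) (H : SimpleGraph W)
      (hG : Generated G) (he : IsLonely G e)
      (hv : v ∈ e ∨ ¬ ∃ J : G.Subgraph, IsJoin v J ∧ e ∈ J.edgeSet)
      (iso : Nonempty (H ≃g replaceByTriangle G v)) : Generated H

end CubicGraph

/-!
Let `G^v` arise from `G` by replacing `v` with a triangle. Each cut of `G` is a cut of `G^v` of the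
same size, and contracting the triangle turns the perfect matchings of `G^v` that use a triangle
edge into the perfect matchings of `G`, and those that use none into the `v`-joins of `G`, in both
cases bijectively. For a lonely edge `e` of `G`, this makes lonely in `G^v` the triangle edge
opposite to `e` if `v` is an end of `e`, and `e` itself if no `v`-join contains `e`.

Conversely, let `M` be the only perfect matching through `e`. If a set `U` with exactly four leaving
edges is matched within itself by `M` and misses an end of `e`, then `U` has no perfect matching
that avoids a given edge `ab` of `M` in `U`. Counting the edges at a Tutte barrier shows that its
odd parts have three leaving edges each, exactly one of them in `M`. Were all of them single
vertices for every choice of `ab`, then `U` would be bipartite up to the edge `ab`, with `a` and `b`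
on the same side. By 3-edge-connectivity the two sides do not depend on `ab`, so that all of `U`
lies on one side and `U = {a, b}`. Otherwise, deleting from a larger odd part the vertex at which
`M` leaves it gives a smaller such `U`. Starting from the complement of one end of `e`, this descent
ends with `U = {a, b}`, which together with the vertex deleted last forms a triangle containing an
edge of `M`. Contracting this triangle gives a smaller graph of the class.
-/

universe w

namespace CubicGraph

open SimpleGraph Set Function

section Isomorphism

variable {V : Type u} {W : Type w} {G : SimpleGraph V} {H : SimpleGraph W}

lemma isPerfectMatching_iff_forall_ncard {M : G.Subgraph} :
    M.IsPerfectMatching ↔ ∀ v, (M.neighborSet v).ncard = 1 := by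
  simp only [Subgraph.isPerfectMatching_iff, ncard_eq_one, eq_singleton_iff_unique_mem]
  rfl

lemma isPerfectMatching_map {M : G.Subgraph} (hM : M.IsPerfectMatching) (φ : G ≃g H) :
    (M.map φ.toHom).IsPerfectMatching :=
  ⟨(Subgraph.Iso.isMatching_map φ).2 hM.1, fun w => ⟨φ.symm w, hM.2 _, φ.apply_symm_apply w⟩⟩

/-- `M` is the only perfect matching that contains the edge `e`. -/
structure IsUniqueMatching (M : G.Subgraph) (e : Sym2 V) : Prop where
  isPerfectMatching : M.IsPerfectMatching
  mem_edgeSet : e ∈ M.edgeSet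
  eq_of_mem_edgeSet : ∀ N : G.Subgraph, N.IsPerfectMatching → e ∈ N.edgeSet → N = M

lemma isLonely_iff {e : Sym2 V} : IsLonely G e ↔ ∃ M : G.Subgraph, IsUniqueMatching M e :=
  ⟨fun ⟨_, M, hM, huniq⟩ => ⟨M, hM.1, hM.2, fun N hN he => huniq N ⟨hN, he⟩⟩,
    fun ⟨M, hM⟩ => ⟨M.edgeSet_subset hM.mem_edgeSet, M, ⟨hM.isPerfectMatching, hM.mem_edgeSet⟩,
      fun N hN => hM.eq_of_mem_edgeSet N hN.1 hN.2⟩⟩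

lemma IsUniqueMatching.map {M : G.Subgraph} {e : Sym2 V} (hM : IsUniqueMatching M e)
    (φ : G ≃g H) : IsUniqueMatching (M.map φ.toHom) (e.map φ) where
  isPerfectMatching := isPerfectMatching_map hM.isPerfectMatching φ
  mem_edgeSet := by
    rw [Subgraph.edgeSet_map]
    exact ⟨e, hM.mem_edgeSet, rfl⟩
  eq_of_mem_edgeSet N hN he := by
    have hNM : N.map φ.symm.toHom = M := by
      refine hM.eq_of_mem_edgeSet _ (isPerfectMatching_map hN φ.symm) ?_
      rw [Subgraph.edgeSet_map]
      exact ⟨_, he, by simp [Sym2.map_map]⟩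
    simp [← hNM, ← Subgraph.map_comp]

lemma IsCubic.of_iso (hG : IsCubic G) (φ : G ≃g H) : IsCubic H := fun w => by
  rw [← hG (φ.symm w), ← Nat.card_coe_set_eq, ← Nat.card_coe_set_eq]
  exact Nat.card_congr (φ.symm.mapNeighborSet w)

lemma IsThreeConnected.of_iso (hG : IsThreeConnected G) (φ : G ≃g H) : IsThreeConnected H := by
  obtain ⟨_, hcard, hconn⟩ := hG
  refine ⟨Finite.of_equiv V φ.toEquiv, by rwa [← Nat.card_congr φ.toEquiv], fun S hS => ?_⟩
  have hS' : (φ ⁻¹' S).ncard < 3 := by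
    rwa [ncard_preimage_of_injective_subset_range φ.injective (by simp [φ.surjective.range_eq])]
  let ψ : G.induce (φ ⁻¹' S)ᶜ ≃g H.induce Sᶜ :=
    { toEquiv := φ.toEquiv.subtypeEquiv fun _ => Iff.rfl
      map_rel_iff' := φ.map_adj_iff }
  exact ψ.connected_iff.1 (hconn _ hS')

lemma InU.of_iso (hG : InU G) (φ : G ≃g H) : InU H :=
  ⟨hG.1.of_iso φ, hG.2.1.of_iso φ, by
    obtain ⟨e, he⟩ := hG.2.2
    obtain ⟨M, hM⟩ := isLonely_iff.1 he
    exact ⟨_, isLonely_iff.2 ⟨_, hM.map φ⟩⟩⟩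

end Isomorphism

section EdgeCount

variable {V : Type u} {G : SimpleGraph V} {A A' B B' S : Set V} {p x y : V} {k : ℕ}

/-- The number of pairs `(a, b)` of adjacent vertices with `a ∈ A` and `b ∈ B`, for arbitrary sets
of vertices; edges inside `A ∩ B` are counted twice. -/
noncomputable def edgeCount (G : SimpleGraph V) (A B : Set V) : ℕ :=
  {q : V × V | q.1 ∈ A ∧ q.2 ∈ B ∧ G.Adj q.1 q.2}.ncard

/-- The number of edges leaving a set of vertices. -/
noncomputable def cutSize (G : SimpleGraph V) (S : Set V) : ℕ :=
  edgeCount G S Sᶜ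

lemma edgeCount_comm : edgeCount G A B = edgeCount G B A :=
  ncard_congr (fun q _ => q.swap) (fun _ h => ⟨h.2.1, h.1, h.2.2.symm⟩)
    (fun _ _ _ _ h => Prod.swap_injective h)
    (fun q h => ⟨q.swap, ⟨h.2.1, h.1, h.2.2.symm⟩, q.swap_swap⟩)

lemma cutSize_compl : cutSize G Sᶜ = cutSize G S := by
  rw [cutSize, compl_compl, edgeCount_comm, cutSize]

lemma edgeCount_singleton_left : edgeCount G {p} B = (G.neighborSet p ∩ B).ncard :=
  ncard_congr (fun q _ => q.2) (by rintro ⟨_, b⟩ ⟨rfl, hb, h⟩; exact ⟨h, hb⟩)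
    (by rintro q r ⟨hq, _⟩ ⟨hr, _⟩ h; exact Prod.ext (hq.trans hr.symm) h)
    (fun b hb => ⟨(p, b), ⟨rfl, hb.2, hb.1⟩, rfl⟩)

variable [Finite V]

lemma edgeCount_eq_zero_iff : edgeCount G A B = 0 ↔ ∀ a ∈ A, ∀ b ∈ B, ¬ G.Adj a b := by
  rw [edgeCount, ncard_eq_zero, eq_empty_iff_forall_notMem, Prod.forall]
  exact ⟨fun h a ha b hb hab => h a b ⟨ha, hb, hab⟩, fun h a b hab => h a hab.1 b hab.2.1 hab.2.2⟩

lemma edgeCount_mono (hA : A ⊆ A') (hB : B ⊆ B') : edgeCount G A B ≤ edgeCount G A' B' :=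
  ncard_le_ncard fun _ h => ⟨hA h.1, hB h.2.1, h.2.2⟩

lemma edgeCount_union_left (h : Disjoint A A') :
    edgeCount G (A ∪ A') B = edgeCount G A B + edgeCount G A' B := by
  rw [edgeCount, edgeCount, edgeCount, ← ncard_union_eq]
  · congr 1
    ext q
    simp only [mem_union, mem_ofPred_eq, or_and_right]
  · exact disjoint_left.2 fun q hq hq' => disjoint_left.1 h hq.1 hq'.1

lemma edgeCount_union_right (h : Disjoint B B') :
    edgeCount G A (B ∪ B') = edgeCount G A B + edgeCount G A B' := by
  rw [edgeCount_comm, edgeCount_union_left h, edgeCount_comm, edgeCount_comm (A := B')]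

lemma edgeCount_iUnion_left {ι : Type*} [Fintype ι] {D : ι → Set V}
    (h : Pairwise (Disjoint on D)) : edgeCount G (⋃ i, D i) B = ∑ i, edgeCount G (D i) B := by
  have hunion : {q : V × V | q.1 ∈ ⋃ i, D i ∧ q.2 ∈ B ∧ G.Adj q.1 q.2} =
      ⋃ i, {q : V × V | q.1 ∈ D i ∧ q.2 ∈ B ∧ G.Adj q.1 q.2} := by
    ext q
    simp only [mem_iUnion, mem_ofPred_eq, exists_and_right]
  rw [edgeCount, hunion, ncard_iUnion_of_finite (fun _ => toFinite _), finsum_eq_sum_of_fintype]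
  · rfl
  · exact fun i j hij => disjoint_left.2 fun q hq hq' => disjoint_left.1 (h hij) hq.1 hq'.1

lemma edgeCount_insert_left (hp : p ∉ A) :
    edgeCount G (insert p A) B = edgeCount G {p} B + edgeCount G A B := by
  rw [insert_eq, edgeCount_union_left (disjoint_singleton_left.2 hp)]

lemma edgeCount_le_mul_ncard (h : ∀ a ∈ A, edgeCount G {a} B ≤ k) :
    edgeCount G A B ≤ k * A.ncard := by
  induction A, A.toFinite using Set.Finite.induction_on with
  | empty => exact (edgeCount_eq_zero_iff.2 (by simp)).le.trans (Nat.zero_le _)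
  | @insert a A ha _ ih =>
    rw [edgeCount_insert_left ha, ncard_insert_of_notMem ha]
    linarith [h a (mem_insert a A), ih fun b hb => h b (mem_insert_of_mem a hb)]

lemma IsCubic.edgeCount_univ (hG : IsCubic G) : edgeCount G A univ = 3 * A.ncard := by
  induction A, A.toFinite using Set.Finite.induction_on with
  | empty => rw [edgeCount_eq_zero_iff.2 (by simp), ncard_empty]
  | @insert a A ha _ ih =>
    rw [edgeCount_insert_left ha, ncard_insert_of_notMem ha, ih, edgeCount_singleton_left,
      inter_univ, hG a, add_comm, mul_add_one]

lemma edgeCount_add_cutSize : edgeCount G S S + cutSize G S = edgeCount G S univ := by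
  rw [cutSize, ← edgeCount_union_right disjoint_compl_right, union_compl_self]

lemma cutSize_eq_add (h : Disjoint A B) :
    cutSize G A = edgeCount G A B + edgeCount G A (A ∪ B)ᶜ := by
  rw [← edgeCount_union_right (disjoint_compl_right.mono_left subset_union_right), cutSize]
  congr 1
  ext q
  have hq : q ∈ A → q ∉ B := fun hA => disjoint_left.1 h hA
  simp only [mem_compl_iff, mem_union]
  tauto

lemma edgeCount_self_le : edgeCount G A A ≤ (A.ncard - 1) * A.ncard :=
  edgeCount_le_mul_ncard fun a ha => by
    rw [edgeCount_singleton_left, ← ncard_sdiff_singleton_of_mem ha]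
    exact ncard_le_ncard fun b hb => ⟨hb.2, fun h => G.ne_of_adj hb.1 h.symm⟩

lemma cutSize_insert (hp : p ∉ S) :
    cutSize G (insert p S) + 2 * edgeCount G {p} S = cutSize G S + (G.neighborSet p).ncard := by
  have hcompl : Sᶜ = {p} ∪ (insert p S)ᶜ := by
    ext q
    by_cases hq : q = p <;> simp [hq, hp]
  have hdisj : Disjoint {p} (insert p S)ᶜ := disjoint_singleton_left.2 fun h => h (mem_insert p S)
  have hself : edgeCount G {p} {p} = 0 := edgeCount_eq_zero_iff.2 (by simp)
  have hdeg : (G.neighborSet p).ncard =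
      edgeCount G {p} S + (edgeCount G {p} {p} + edgeCount G {p} (insert p S)ᶜ) := by
    rw [← edgeCount_union_right hdisj, ← hcompl, ← edgeCount_union_right disjoint_compl_right,
      union_compl_self, edgeCount_singleton_left, inter_univ]
  have hcut : cutSize G S = edgeCount G {p} S + edgeCount G S (insert p S)ᶜ := by
    rw [cutSize, hcompl, edgeCount_union_right hdisj, edgeCount_comm]
  have hinsert : cutSize G (insert p S) =
      edgeCount G {p} (insert p S)ᶜ + edgeCount G S (insert p S)ᶜ := edgeCount_insert_left hp
  omega

lemma two_le_edgeCount_singleton (hx : G.Adj p x) (hy : G.Adj p y) (hxy : x ≠ y) (hxS : x ∈ S)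
    (hyS : y ∈ S) : 2 ≤ edgeCount G {p} S := by
  rw [edgeCount_singleton_left, ← ncard_pair hxy]
  exact ncard_le_ncard (by rintro _ (rfl | rfl) <;> constructor <;> assumption)

lemma IsCubic.cutSize_insert_lt (hG : IsCubic G) (hp : p ∉ S) (hx : G.Adj p x) (hy : G.Adj p y)
    (hxy : x ≠ y) (hxS : x ∈ S) (hyS : y ∈ S) : cutSize G (insert p S) < cutSize G S := by
  have := cutSize_insert (G := G) hp
  have := two_le_edgeCount_singleton hx hy hxy hxS hyS
  have := hG p
  omega

lemma IsCubic.cutSize_singleton (hG : IsCubic G) : cutSize G {p} = 3 := by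
  have hself : edgeCount G {p} {p} = 0 := edgeCount_eq_zero_iff.2 (by simp)
  have := edgeCount_add_cutSize (G := G) (S := {p})
  rw [hself, hG.edgeCount_univ, ncard_singleton] at this
  omega

lemma cutSize_le_ncard_edges {E : Set (Sym2 V)}
    (h : ∀ a ∈ S, ∀ b ∉ S, G.Adj a b → s(a, b) ∈ E) : cutSize G S ≤ E.ncard := by
  refine ncard_le_ncard_of_injOn (fun q => s(q.1, q.2)) (fun q hq => h _ hq.1 _ hq.2.1 hq.2.2) ?_
  rintro ⟨a, b⟩ ⟨ha, -, -⟩ ⟨a', b'⟩ ⟨ha', hb', -⟩ hab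
  rcases Sym2.eq_iff.1 hab with ⟨rfl, rfl⟩ | ⟨rfl, rfl⟩
  · rfl
  · exact absurd ha hb'

end EdgeCount

section ThreeEdgeConnected

variable {V : Type u} {G : SimpleGraph V} {A S : Set V}

/-- Every nontrivial edge cut has at least three edges. For a cubic graph with more than three
vertices this amounts to being 3-connected, and it is the form in which 3-connectedness is used. -/
def IsThreeEdgeConnected (G : SimpleGraph V) : Prop :=
  ∀ S : Set V, S.Nonempty → Sᶜ.Nonempty → 3 ≤ cutSize G S

lemma exists_adj_of_connected_induce (hG : (G.induce A).Connected) (hp : (A ∩ S).Nonempty)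
    (hq : (A \ S).Nonempty) : ∃ a ∈ A ∩ S, ∃ b ∈ A \ S, G.Adj a b := by
  obtain ⟨p, hpA, hpS⟩ := hp
  obtain ⟨q, hqA, hqS⟩ := hq
  obtain ⟨walk⟩ := hG.preconnected ⟨p, hpA⟩ ⟨q, hqA⟩
  obtain ⟨d, -, hd, hd'⟩ := walk.exists_boundary_dart (Subtype.val ⁻¹' S) hpS hqS
  exact ⟨d.fst, ⟨d.fst.2, hd⟩, d.snd, ⟨d.snd.2, hd'⟩, d.adj⟩

lemma connected_induce_of_forall_exists_adj (hA : A.Nonempty)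
    (h : ∀ S, (A ∩ S).Nonempty → (A \ S).Nonempty → ∃ a ∈ A ∩ S, ∃ b ∈ A \ S, G.Adj a b) :
    (G.induce A).Connected := by
  obtain ⟨p, hp⟩ := hA
  refine (connected_iff_exists_forall_reachable _).2 ⟨⟨p, hp⟩, fun q => ?_⟩
  by_contra hq
  obtain ⟨_, ⟨-, a, ha, rfl⟩, b, ⟨hbA, hbS⟩, hab⟩ :=
    h (Subtype.val '' {a | (G.induce A).Reachable ⟨p, hp⟩ a}) ⟨p, hp, ⟨p, hp⟩, Reachable.rfl, rfl⟩
      ⟨q, q.2, fun ⟨a, ha, haq⟩ => hq (Subtype.ext haq ▸ ha)⟩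
  have hab' : (G.induce A).Adj a ⟨b, hbA⟩ := hab
  exact hbS ⟨⟨b, hbA⟩, Reachable.trans ha hab'.reachable, rfl⟩

variable [Finite V]

lemma IsCubic.three_lt_card [Nonempty V] (hG : IsCubic G) : 3 < Nat.card V := by
  obtain ⟨v⟩ := ‹Nonempty V›
  have h : (insert v (G.neighborSet v)).ncard = 4 := by
    rw [ncard_insert_of_notMem (by simp), hG v]
  have := ncard_le_card (insert v (G.neighborSet v))
  omega

lemma IsCubic.three_le_cutSize_of_ncard_le_two (hG : IsCubic G) (hS : S.Nonempty)
    (hcard : S.ncard ≤ 2) : 3 ≤ cutSize G S := by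
  have hpos : 0 < S.ncard := hS.ncard_pos
  have hinner := edgeCount_self_le (G := G) (A := S)
  have hsum := edgeCount_add_cutSize (G := G) (S := S)
  rw [hG.edgeCount_univ] at hsum
  interval_cases S.ncard <;> omega

omit [Finite V] in
theorem IsThreeConnected.isThreeEdgeConnected (hconn : IsThreeConnected G) (hG : IsCubic G) :
    IsThreeEdgeConnected G := by
  have : Finite V := hconn.1
  intro S hS hSc
  by_contra! hcut
  set X : Set V := Prod.fst '' {q : V × V | q.1 ∈ S ∧ q.2 ∈ Sᶜ ∧ G.Adj q.1 q.2}
  have hX : X.ncard < 3 := (ncard_image_le (toFinite _)).trans_lt hcut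
  have hXS : X ⊆ S := by
    rintro _ ⟨q, hq, rfl⟩
    exact hq.1
  by_cases hSX : S ⊆ X
  · have := hG.three_le_cutSize_of_ncard_le_two hS (by have := ncard_le_ncard hSX; omega)
    omega
  · obtain ⟨p, hpS, hpX⟩ := not_subset.1 hSX
    obtain ⟨q, hq⟩ := hSc
    obtain ⟨a, ha, b, hb, hab⟩ := exists_adj_of_connected_induce (S := S) (hconn.2.2 X hX)
      ⟨p, hpX, hpS⟩ ⟨q, fun h => hq (hXS h), hq⟩
    exact ha.1 ⟨(a, b), ⟨ha.2, hb.2, hab⟩, rfl⟩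

/-- If `P` and `Q` are the two sides left by the deletion of at most two vertices, then each of
them has exactly three leaving edges, and adding one of the deleted vertices to `P` shows that this
vertex has at most one neighbour in `P`. -/
lemma IsThreeEdgeConnected.three_le_ncard_separator (hcut : IsThreeEdgeConnected G)
    (hG : IsCubic G) {P Q : Set V} (hP : P.Nonempty) (hQ : Q.Nonempty) (hPQ : Disjoint P Q)
    (hno : edgeCount G P Q = 0) : 3 ≤ (P ∪ Q)ᶜ.ncard := by
  by_contra! hX
  set X := (P ∪ Q)ᶜ
  have hcutP : cutSize G P = edgeCount G X P := by
    rw [cutSize_eq_add hPQ, hno, zero_add, edgeCount_comm]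
  have hcutQ : cutSize G Q = edgeCount G X Q := by
    rw [cutSize_eq_add hPQ.symm, edgeCount_comm, hno, zero_add, edgeCount_comm, union_comm]
  have hsum : edgeCount G X P + edgeCount G X Q ≤ 3 * X.ncard := by
    rw [← edgeCount_union_right hPQ, ← hG.edgeCount_univ]
    exact edgeCount_mono subset_rfl (subset_univ _)
  have hthreeP := hcut P hP (hQ.mono hPQ.subset_compl_left)
  have hthreeQ := hcut Q hQ (hP.mono hPQ.subset_compl_right)
  have hdegree : ∀ s ∈ X, edgeCount G {s} P ≤ 1 := by
    intro s hs
    have hthree := hcut (insert s P) (insert_nonempty s P) (hQ.mono fun q hq hqs => ?_)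
    · have := cutSize_insert (G := G) (p := s) (S := P) fun h => hs (Or.inl h)
      have := hG s
      omega
    · rcases hqs with rfl | hqP
      · exact hs (Or.inr hq)
      · exact disjoint_left.1 hPQ hqP hq
  have := edgeCount_le_mul_ncard hdegree
  omega

theorem IsThreeEdgeConnected.isThreeConnected [Nonempty V] (hcut : IsThreeEdgeConnected G)
    (hG : IsCubic G) : IsThreeConnected G := by
  have hcard := hG.three_lt_card
  refine ⟨inferInstance, hcard, fun X hX => connected_induce_of_forall_exists_adj ?_ ?_⟩
  · refine nonempty_compl.2 fun hX' => ?_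
    rw [hX', ncard_univ] at hX
    omega
  · intro S hS hSc
    by_contra! hno
    have := hcut.three_le_ncard_separator hG hS hSc
      (disjoint_sdiff_right.mono_left inter_subset_right) (edgeCount_eq_zero_iff.2 hno)
    rw [inter_union_sdiff, compl_compl] at this
    omega

end ThreeEdgeConnected

section Barrier

variable {V : Type u} {G H : SimpleGraph V} {M : G.Subgraph} {U : Set V} {a b : V}
  {ι : Type*} [Fintype ι]

/-- A violation of Tutte's condition for the subgraph of `H` induced by `U`: the sets `D i` are odd
and are unions of components of `H[U \ X]`, and there are at least two more of them than there are
vertices in `X`. -/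
structure IsBarrier (H : SimpleGraph V) (U X : Set V) (D : ι → Set V) : Prop where
  subset : X ⊆ U
  part_subset : ∀ i, D i ⊆ U \ X
  odd_ncard : ∀ i, Odd (D i).ncard
  pairwise_disjoint : Pairwise (Disjoint on D)
  mem_of_adj : ∀ i, ∀ p ∈ D i, ∀ q ∈ U \ X, H.Adj p q → q ∈ D i
  ncard_add_two_le : X.ncard + 2 ≤ Fintype.card ι

lemma IsBarrier.of_induce {X : Set U} {D : ι → Set U} (h : IsBarrier (H.induce U) univ X D) :
    IsBarrier H U (Subtype.val '' X) fun i => Subtype.val '' D i where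
  subset := image_subset_iff.2 fun p _ => p.2
  part_subset i := by
    rintro _ ⟨p, hp, rfl⟩
    exact ⟨p.2, fun hpX => (h.part_subset i hp).2 (Subtype.val_injective.mem_set_image.1 hpX)⟩
  odd_ncard i := by
    rw [ncard_image_of_injective _ Subtype.val_injective]
    exact h.odd_ncard i
  pairwise_disjoint i j hij :=
    (disjoint_image_iff Subtype.val_injective).2 (h.pairwise_disjoint hij)
  mem_of_adj := by
    rintro i _ ⟨p, hp, rfl⟩ q ⟨hqU, hqX⟩ hpq
    exact ⟨⟨q, hqU⟩, h.mem_of_adj i p hp ⟨q, hqU⟩ ⟨trivial, fun hq => hqX ⟨_, hq, rfl⟩⟩ hpq, rfl⟩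
  ncard_add_two_le := by
    rw [ncard_image_of_injective _ Subtype.val_injective]
    exact h.ncard_add_two_le

lemma exists_isPerfectMatching_of_induce (hM : M.IsPerfectMatching)
    (hU : ∀ p ∈ U, ∀ q, M.Adj p q → q ∈ U) (hH : H ≤ G) {K : (H.induce U).Subgraph}
    (hK : K.IsPerfectMatching) :
    ∃ N : G.Subgraph, N.IsPerfectMatching ∧ (∀ p ∈ U, ∀ q, N.Adj p q → H.Adj p q) ∧
      ∀ p ∉ U, ∀ q, M.Adj p q → N.Adj p q := by
  let f : H.induce U →g G := (Hom.ofLE hH).comp (Embedding.induce U).toHom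
  have hUc : ∀ p ∉ U, ∀ q, M.Adj p q → q ∉ U := fun p hp q hpq hq => hp (hU q hq p hpq.symm)
  have hKf : (K.map f).IsMatching := hK.1.map f Subtype.val_injective
  have hMc : (M.induce Uᶜ).IsMatching := by
    intro p hp
    obtain ⟨q, hpq, huniq⟩ := hM.1 (hM.2 p)
    exact ⟨q, ⟨hp, hUc p hp q hpq, hpq⟩, fun r hr => huniq r hr.2.2⟩
  have hvertsK : (K.map f).verts ⊆ U := by
    rintro _ ⟨p, -, rfl⟩
    exact p.2
  refine ⟨K.map f ⊔ M.induce Uᶜ, ⟨hKf.sup hMc ?_, fun p => ?_⟩, ?_, ?_⟩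
  · rw [hKf.support_eq_verts, hMc.support_eq_verts]
    exact disjoint_compl_right.mono_left hvertsK
  · by_cases hp : p ∈ U
    · exact Or.inl ⟨⟨p, hp⟩, hK.2 _, rfl⟩
    · exact Or.inr hp
  · rintro p hp q (⟨p', q', hpq, rfl, rfl⟩ | hpq)
    · exact hpq.adj_sub
    · exact absurd hp hpq.1
  · exact fun p hp q hpq => Or.inr ⟨hp, hUc p hp q hpq, hpq⟩

variable [Finite V]

lemma exists_isBarrier_univ (heven : Even (Nat.card V)) (hH : H.IsMatchingFree) :
    ∃ (X : Set V) (ι : Type u) (_ : Fintype ι) (D : ι → Set V), IsBarrier H univ X D := by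
  obtain ⟨X, hX⟩ : ∃ X, H.IsTutteViolator X := by
    by_contra! h
    obtain ⟨M, hM⟩ := tutte.2 h
    exact hH M hM
  set K := ((⊤ : H.Subgraph).deleteVerts X).coe
  have := Fintype.ofFinite K.oddComponents
  refine ⟨X, K.oddComponents, this, fun c => Subtype.val '' c.1.supp,
    subset_univ X, fun c => ?_, fun c => ?_, fun c c' hcc' => ?_, ?_, ?_⟩
  · rintro _ ⟨p, -, rfl⟩
    exact p.2
  · rw [ncard_image_of_injective _ Subtype.val_injective]
    exact c.2
  · refine (disjoint_image_iff Subtype.val_injective).2 ?_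
    exact pairwise_disjoint_supp_connectedComponent K (Subtype.val_injective.ne hcc')
  · rintro c _ ⟨p, hp, rfl⟩ q hq hpq
    refine ⟨⟨q, hq⟩, (c.1.mem_supp_congr_adj ?_).1 hp, rfl⟩
    exact Subgraph.deleteVerts_adj.2 ⟨trivial, p.2.2, trivial, hq.2, hpq⟩
  · have hodd := K.odd_ncard_oddComponents
    have hcard : Nat.card ((⊤ : H.Subgraph).deleteVerts X).verts + X.ncard = Nat.card V := by
      rw [Nat.card_coe_set_eq, Subgraph.deleteVerts_verts, Subgraph.verts_top,
        ncard_sdiff_add_ncard_of_subset (subset_univ X), ncard_univ]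
    rw [Nat.odd_iff, Nat.odd_iff] at hodd
    rw [Nat.even_iff] at heven
    rw [← Nat.card_eq_fintype_card, Nat.card_coe_set_eq]
    have : X.ncard < K.oddComponents.ncard := hX
    omega

lemma even_ncard_of_matched (hM : M.IsPerfectMatching) (hU : ∀ p ∈ U, ∀ q, M.Adj p q → q ∈ U) :
    Even U.ncard := by
  have hind : (M.induce U).IsMatching := by
    intro p hp
    obtain ⟨q, hpq, huniq⟩ := hM.1 (hM.2 p)
    exact ⟨q, ⟨hp, hU p hp q hpq, hpq⟩, fun r hr => huniq r hr.2.2⟩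
  have : Fintype (M.induce U).verts := Fintype.ofFinite _
  have := hind.even_card
  rwa [← ncard_eq_toFinset_card'] at this

/-- A perfect matching of `U` without the edge `ab` could be combined with `M` outside `U` to a
second perfect matching through `e`. -/
lemma IsUniqueMatching.exists_isBarrier {e : Sym2 V} (hM : IsUniqueMatching M e)
    (hU : ∀ p ∈ U, ∀ q, M.Adj p q → q ∈ U) {x : V} (hxe : x ∈ e) (hxU : x ∉ U) (hab : M.Adj a b)
    (ha : a ∈ U) :
    ∃ (X : Set V) (ι : Type u) (_ : Fintype ι) (D : ι → Set V),
      IsBarrier (G.deleteEdges {s(a, b)}) U X D := by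
  have heven : Even (Nat.card U) := by
    rw [Nat.card_coe_set_eq]
    exact even_ncard_of_matched hM.isPerfectMatching hU
  have hfree : ((G.deleteEdges {s(a, b)}).induce U).IsMatchingFree := by
    intro K hK
    obtain ⟨N, hN, hNU, hNUc⟩ :=
      exists_isPerfectMatching_of_induce hM.isPerfectMatching hU (deleteEdges_le _) hK
    obtain ⟨y, rfl⟩ := hxe
    obtain rfl := hM.eq_of_mem_edgeSet N hN (hNUc x hxU y hM.mem_edgeSet)
    simpa using hNU a ha b hab
  obtain ⟨X, ι, _, D, hD⟩ := exists_isBarrier_univ heven hfree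
  exact ⟨_, ι, _, _, hD.of_induce⟩

end Barrier

section TightBarrier

variable {V : Type u} {G : SimpleGraph V} {U X Z : Set V} {a b : V}
  {ι : Type*} [Fintype ι] {D : ι → Set V}

/-- The shape forced on a barrier of `U` for the graph `G` without the edge `ab` when exactly four
edges leave `U`: the parts `D i` cover `U \ X` and have three leaving edges each, the edges at `X`
all lead to parts, and the only edge between two different parts is `ab`. -/
structure IsTightBarrier (G : SimpleGraph V) (U X : Set V) (D : ι → Set V) (a b : V) : Prop where
  subset : X ⊆ U
  iUnion_eq : ⋃ i, D i = U \ X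
  odd_ncard : ∀ i, Odd (D i).ncard
  pairwise_disjoint : Pairwise (Disjoint on D)
  cutSize_eq_three : ∀ i, cutSize G (D i) = 3
  mem_of_adj : ∀ p ∈ X, ∀ q, G.Adj p q → q ∈ U \ X
  eq_of_adj : ∀ i, ∀ p ∈ D i, ∀ q ∈ U \ X, q ∉ D i → G.Adj p q → s(p, q) = s(a, b)
  card_eq : Fintype.card ι = X.ncard + 2
  pair_subset : {a, b} ⊆ U \ X

lemma IsBarrier.eq_of_adj (hB : IsBarrier (G.deleteEdges {s(a, b)}) U X D) {i : ι} {p q : V}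
    (hp : p ∈ D i) (hq : q ∈ U \ X) (hqD : q ∉ D i) (hpq : G.Adj p q) : s(p, q) = s(a, b) := by
  by_contra h
  exact hqD (hB.mem_of_adj i p hp q hq (deleteEdges_adj.2 ⟨hpq, h⟩))

lemma IsBarrier.iUnion_subset {H : SimpleGraph V} (hB : IsBarrier H U X D) :
    ⋃ i, D i ⊆ U \ X :=
  Set.iUnion_subset hB.part_subset

variable [Finite V]

lemma IsBarrier.sum_edgeCount_parts_le (hB : IsBarrier (G.deleteEdges {s(a, b)}) U X D) :
    ∑ i, edgeCount G (D i) ((U \ X) \ D i) ≤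
      (Prod.fst ⁻¹' (⋃ i, D i) ∩ {(a, b), (b, a)}).ncard := by
  let E : ι → Set (V × V) := fun i => {q | q.1 ∈ D i ∧ q.2 ∈ (U \ X) \ D i ∧ G.Adj q.1 q.2}
  have hE : Pairwise (Disjoint on E) := fun i j hij => disjoint_left.2 fun q hq hq' =>
    disjoint_left.1 (hB.pairwise_disjoint hij) hq.1 hq'.1
  calc ∑ i, edgeCount G (D i) ((U \ X) \ D i) = (⋃ i, E i).ncard := by
        rw [ncard_iUnion_of_finite (fun _ => toFinite _) hE, finsum_eq_sum_of_fintype]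
        rfl
    _ ≤ _ := ncard_le_ncard fun ⟨p, q⟩ hpq => by
        obtain ⟨i, hp, hq, hadj⟩ := mem_iUnion.1 hpq
        refine ⟨mem_iUnion.2 ⟨i, hp⟩, ?_⟩
        rcases Sym2.eq_iff.1 (hB.eq_of_adj hp hq.1 hq.2 hadj) with ⟨rfl, rfl⟩ | ⟨rfl, rfl⟩ <;> simp

lemma cutSize_part_eq {P : Set V} (hX : X ⊆ U) (hP : P ⊆ U \ X) :
    cutSize G P = edgeCount G P X + edgeCount G P Uᶜ + edgeCount G P ((U \ X) \ P) := by
  have hcompl : Pᶜ = (X ∪ Uᶜ) ∪ ((U \ X) \ P) := by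
    ext q
    have hqX : q ∈ X → q ∈ U := fun h => hX h
    have hqP : q ∈ P → q ∈ U \ X := fun h => hP h
    simp only [mem_compl_iff, mem_union, mem_sdiff] at hqP ⊢
    tauto
  have hdisj : Disjoint (X ∪ Uᶜ) ((U \ X) \ P) :=
    (disjoint_union_left.2 ⟨disjoint_sdiff_right,
      disjoint_compl_left.mono_right sdiff_subset⟩).mono_right sdiff_subset
  rw [cutSize, hcompl, edgeCount_union_right hdisj,
    edgeCount_union_right (disjoint_compl_right.mono_left hX)]

/-- Counts the edges at `X` and the edges leaving `U` by the parts `X`, `Z` and `(U \ X) \ Z` of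
`U` that they meet. -/
lemma IsCubic.edgeCount_partition (hG : IsCubic G) (hX : X ⊆ U) (hZ : Z ⊆ U \ X) :
    edgeCount G Z X + edgeCount G Z Uᶜ + (edgeCount G X X + edgeCount G X ((U \ X) \ Z) +
      2 * edgeCount G X Uᶜ + edgeCount G ((U \ X) \ Z) Uᶜ) = 3 * X.ncard + cutSize G U := by
  have hU : X ∪ (Z ∪ (U \ X) \ Z) = U := by rw [union_sdiff_cancel hZ, union_sdiff_cancel hX]
  have hdisjX : Disjoint X (Z ∪ (U \ X) \ Z) := by
    rw [union_sdiff_cancel hZ]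
    exact disjoint_sdiff_right
  have hleaving : cutSize G U =
      edgeCount G X Uᶜ + (edgeCount G Z Uᶜ + edgeCount G ((U \ X) \ Z) Uᶜ) := by
    rw [cutSize, ← edgeCount_union_left disjoint_sdiff_right, ← edgeCount_union_left hdisjX, hU]
  have hdegree : 3 * X.ncard = edgeCount G X X +
      (edgeCount G X Z + edgeCount G X ((U \ X) \ Z)) + edgeCount G X Uᶜ := by
    rw [← edgeCount_union_right disjoint_sdiff_right, ← edgeCount_union_right hdisjX, hU,
      ← edgeCount_union_right disjoint_compl_right, union_compl_self, hG.edgeCount_univ]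
  rw [edgeCount_comm (A := Z) (B := X)]
  omega

/-- If `X` has `n` vertices, then at least `n + 2` parts with at least three leaving edges each
account for `3 * n + 6` edge ends, whereas the edges at `X`, the four edges leaving `U` and the two
ends of `ab` provide at most `3 * n + 4 + 2`. -/
lemma IsBarrier.tight_counts (hB : IsBarrier (G.deleteEdges {s(a, b)}) U X D) (hG : IsCubic G)
    (hthree : ∀ i, 3 ≤ cutSize G (D i)) (hU : cutSize G U = 4) :
    (∀ i, cutSize G (D i) = 3) ∧ Fintype.card ι = X.ncard + 2 ∧
      2 ≤ (Prod.fst ⁻¹' (⋃ i, D i) ∩ {(a, b), (b, a)}).ncard ∧ edgeCount G X X = 0 ∧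
      edgeCount G X ((U \ X) \ ⋃ i, D i) = 0 ∧ edgeCount G X Uᶜ = 0 ∧
      edgeCount G ((U \ X) \ ⋃ i, D i) Uᶜ = 0 := by
  have hsum : ∑ i, cutSize G (D i) = edgeCount G (⋃ i, D i) X + edgeCount G (⋃ i, D i) Uᶜ +
      ∑ i, edgeCount G (D i) ((U \ X) \ D i) := by
    rw [edgeCount_iUnion_left hB.pairwise_disjoint, edgeCount_iUnion_left hB.pairwise_disjoint,
      ← Finset.sum_add_distrib, ← Finset.sum_add_distrib]
    exact Finset.sum_congr rfl fun i _ => cutSize_part_eq hB.subset (hB.part_subset i)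
  have hpair : (Prod.fst ⁻¹' (⋃ i, D i) ∩ {(a, b), (b, a)}).ncard ≤ 2 :=
    (ncard_le_ncard inter_subset_right).trans ((ncard_insert_le _ _).trans_eq (by simp))
  have hlower : ∑ _i : ι, 3 ≤ ∑ i, cutSize G (D i) := Finset.sum_le_sum fun i _ => hthree i
  have hparts := hB.sum_edgeCount_parts_le
  have hcount := hG.edgeCount_partition hB.subset hB.iUnion_subset
  have hcard := hB.ncard_add_two_le
  have hconst : ∑ _i : ι, 3 = 3 * Fintype.card ι := by simp [mul_comm]
  refine ⟨fun i => ?_, by omega, by omega, by omega, by omega, by omega, by omega⟩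
  have heq : ∑ _i : ι, 3 = ∑ i, cutSize G (D i) := by omega
  exact ((Finset.sum_eq_sum_iff_of_le fun i _ => hthree i).1 heq i (Finset.mem_univ i)).symm

theorem IsBarrier.isTightBarrier (hB : IsBarrier (G.deleteEdges {s(a, b)}) U X D) (hG : IsCubic G)
    (hcut : IsThreeEdgeConnected G) (hU : cutSize G U = 4) : IsTightBarrier G U X D a b := by
  have hUc : Uᶜ.Nonempty := by
    by_contra! h
    rw [cutSize, h, edgeCount_eq_zero_iff.2 (by simp)] at hU
    omega
  obtain ⟨hthree, hcard, hpair, hXX, hXR, hXU, hRU⟩ := hB.tight_counts hG (fun i => hcut _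
    (nonempty_of_ncard_ne_zero (hB.odd_ncard i).pos.ne')
    (hUc.mono (compl_subset_compl.2 ((hB.part_subset i).trans sdiff_subset)))) hU
  have hends : {(a, b), (b, a)} ⊆ Prod.fst ⁻¹' ⋃ i, D i := by
    rw [← inter_eq_right]
    refine eq_of_subset_of_ncard_le inter_subset_right (le_trans ?_ hpair)
    exact (ncard_insert_le _ _).trans_eq (by simp)
  have ha : a ∈ ⋃ i, D i := hends (Or.inl rfl)
  have hb : b ∈ ⋃ i, D i := hends (Or.inr rfl)
  have hcover : ⋃ i, D i = U \ X := by
    refine hB.iUnion_subset.antisymm (sdiff_eq_empty.1 ?_)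
    by_contra! hR
    have hthreeR := hcut _ hR (hUc.mono
      (compl_subset_compl.2 (sdiff_subset.trans sdiff_subset)))
    rw [cutSize_part_eq hB.subset sdiff_subset, edgeCount_comm, hXR, hRU, sdiff_sdiff_cancel_left
      hB.iUnion_subset, edgeCount_eq_zero_iff.2] at hthreeR
    · omega
    · rintro p ⟨hpUX, hpZ⟩ q hq hpq
      obtain ⟨i, hqi⟩ := mem_iUnion.1 hq
      have := hB.eq_of_adj hqi hpUX (fun hpi => hpZ (mem_iUnion.2 ⟨i, hpi⟩)) hpq.symm
      rcases Sym2.eq_iff.1 this with ⟨rfl, rfl⟩ | ⟨rfl, rfl⟩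
      exacts [hpZ hb, hpZ ha]
  refine ⟨hB.subset, hcover, hB.odd_ncard, hB.pairwise_disjoint, hthree, fun p hp q hpq => ⟨?_, ?_⟩,
    fun _ _ hp _ hq hqD => hB.eq_of_adj hp hq hqD, hcard,
    hcover ▸ pair_subset ha hb⟩
  · by_contra hq
    exact edgeCount_eq_zero_iff.1 hXU p hp q hq hpq
  · exact fun hq => edgeCount_eq_zero_iff.1 hXX p hp q hq hpq

end TightBarrier

section Triangle

variable {V : Type u} {G : SimpleGraph V} {M : G.Subgraph} {S U X Y : Set V} {a b s x : V}
  {e f g : Sym2 V} {ι : Type*} [Fintype ι] {D : ι → Set V}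

/-- The vertices of `S` that `M` matches to a vertex outside `S`. -/
def crossing (M : G.Subgraph) (S : Set V) : Set V :=
  {p ∈ S | ∃ q, M.Adj p q ∧ q ∉ S}

lemma mem_of_adj_of_crossing_eq_empty (hS : crossing M S = ∅) :
    ∀ p ∈ S, ∀ q, M.Adj p q → q ∈ S := by
  intro p hp q hpq
  by_contra hq
  exact eq_empty_iff_forall_notMem.1 hS p ⟨hp, q, hpq, hq⟩

lemma mem_of_adj_of_crossing_eq_singleton (hM : M.IsMatching) (hS : crossing M S = {s}) :
    ∀ p ∈ S \ {s}, ∀ q, M.Adj p q → q ∈ S \ {s} := by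
  rintro p ⟨hp, hps⟩ q hpq
  obtain ⟨-, r, hsr, hr⟩ : s ∈ crossing M S := hS ▸ mem_singleton s
  refine ⟨by_contra fun hq => hps (hS ▸ ⟨hp, q, hpq, hq⟩), ?_⟩
  rintro rfl
  exact hr (hM.eq_of_adj_left hsr hpq.symm ▸ hp)

/-- The set `U` is split into `X` and `U \ X` such that all edges at `X` lead to `U \ X`, and no
edge other than `f` joins two vertices of `U \ X`. -/
structure IsNearBipartition (G : SimpleGraph V) (U X : Set V) (f : Sym2 V) : Prop where
  subset : X ⊆ U
  mem_of_adj : ∀ p ∈ X, ∀ q, G.Adj p q → q ∈ U \ X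
  eq_of_adj : ∀ p ∈ U \ X, ∀ q ∈ U \ X, G.Adj p q → s(p, q) = f

lemma IsTightBarrier.isNearBipartition (hB : IsTightBarrier G U X D a b)
    (hD : ∀ i, (D i).Subsingleton) : IsNearBipartition G U X s(a, b) where
  subset := hB.subset
  mem_of_adj := hB.mem_of_adj
  eq_of_adj p hp q hq hpq := by
    obtain ⟨i, hi⟩ := mem_iUnion.1 (hB.iUnion_eq ▸ hp)
    exact hB.eq_of_adj i p hi q hq (fun hqi => hpq.ne (hD i hi hqi)) hpq

variable [Finite V]

lemma crossing_nonempty_of_odd (hM : M.IsPerfectMatching) (hS : Odd S.ncard) :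
    (crossing M S).Nonempty := by
  by_contra! h
  exact Nat.not_even_iff_odd.2 hS (even_ncard_of_matched hM (mem_of_adj_of_crossing_eq_empty h))

/-- A vertex with partner outside its part is an end of `ab` or the partner of a vertex of `X`, so
there are at most `X.ncard + 2` such vertices, as many as there are parts. -/
lemma IsTightBarrier.ncard_crossing_eq_one (hB : IsTightBarrier G U X D a b)
    (hM : M.IsPerfectMatching) (hU : ∀ p ∈ U, ∀ q, M.Adj p q → q ∈ U) (i : ι) :
    (crossing M (D i)).ncard = 1 := by
  have hpos : ∀ i, 1 ≤ (crossing M (D i)).ncard := fun i =>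
    (crossing_nonempty_of_odd hM (hB.odd_ncard i)).ncard_pos
  have hpartner : ∀ p, ∃ q, M.Adj p q := fun p => (hM.1 (hM.2 p)).exists
  choose m hm using hpartner
  have hsub : ⋃ i, crossing M (D i) ⊆ m '' X ∪ {a, b} := by
    refine Set.iUnion_subset fun i => ?_
    rintro p ⟨hp, q, hpq, hq⟩
    have hpU : p ∈ U \ X := hB.iUnion_eq ▸ mem_iUnion.2 ⟨i, hp⟩
    by_cases hqX : q ∈ X
    · exact Or.inl ⟨q, hqX, hM.1.eq_of_adj_left (hm q) hpq.symm⟩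
    · rcases Sym2.eq_iff.1 (hB.eq_of_adj i p hp q ⟨hU p hpU.1 q hpq, hqX⟩ hq hpq.adj_sub) with
        ⟨rfl, -⟩ | ⟨rfl, -⟩
      exacts [Or.inr (Or.inl rfl), Or.inr (Or.inr rfl)]
  have hdisj : Pairwise (Disjoint on fun i => crossing M (D i)) := fun i j hij =>
    (hB.pairwise_disjoint hij).mono (sep_subset _ _) (sep_subset _ _)
  have hupper : ∑ i, (crossing M (D i)).ncard ≤ ∑ _i : ι, 1 := by
    rw [← finsum_eq_sum_of_fintype, ← ncard_iUnion_of_finite (fun _ => toFinite _) hdisj,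
      Finset.sum_const, Finset.card_univ, hB.card_eq, smul_eq_mul, mul_one]
    refine (ncard_le_ncard hsub).trans ((ncard_union_le _ _).trans (add_le_add ?_ ?_))
    · exact ncard_image_le
    · exact (ncard_insert_le _ _).trans_eq (by simp)
  have heq := (Finset.sum_eq_sum_iff_of_le fun i _ => hpos i).1
    (le_antisymm (Finset.sum_le_sum fun i _ => hpos i) hupper)
  exact (heq i (Finset.mem_univ i)).symm

lemma IsNearBipartition.cutSize_symmDiff_le (hX : IsNearBipartition G U X f)
    (hY : IsNearBipartition G U Y g) : cutSize G (symmDiff X Y) ≤ 2 := by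
  have hle : cutSize G (symmDiff X Y) ≤ ({f, g} : Set (Sym2 V)).ncard := by
    refine cutSize_le_ncard_edges fun p hp q hq hpq => ?_
    rw [mem_symmDiff, not_or, not_and_not_right, not_and_not_right] at hq
    rcases hp with ⟨hpX, hpY⟩ | ⟨hpY, hpX⟩
    · have hqX := hX.mem_of_adj p hpX q hpq
      exact Or.inr (hY.eq_of_adj p ⟨hX.subset hpX, hpY⟩ q ⟨hqX.1, fun h => hqX.2 (hq.2 h)⟩ hpq)
    · have hqY := hY.mem_of_adj p hpY q hpq
      exact Or.inl (hX.eq_of_adj p ⟨hY.subset hpY, hpX⟩ q ⟨hqY.1, fun h => hqY.2 (hq.1 h)⟩ hpq)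
  exact hle.trans ((ncard_insert_le _ _).trans_eq (by simp))

lemma IsNearBipartition.unique (hcut : IsThreeEdgeConnected G) (hX : IsNearBipartition G U X f)
    (hY : IsNearBipartition G U Y g) (hU : Uᶜ.Nonempty) : X = Y := by
  by_contra hne
  have := hX.cutSize_symmDiff_le hY
  have := hcut (symmDiff X Y) (symmDiff_nonempty.2 hne)
    (hU.mono (compl_subset_compl.2 fun q hq =>
      hq.elim (fun h => hX.subset h.1) fun h => hY.subset h.1))
  omega

/-- If all the parts of every tight barrier were single vertices, then they would all have the same
set `X`, and a matching edge at a vertex of `X` has no tight barrier with that `X`. -/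
lemma exists_cutSize_eq_three_or_subset_pair (hG : IsCubic G) (hcut : IsThreeEdgeConnected G)
    (hM : IsUniqueMatching M e) (hxe : x ∈ e) (hxU : x ∉ U) (hUM : ∀ p ∈ U, ∀ q, M.Adj p q → q ∈ U)
    (hU : U.Nonempty) (hU4 : cutSize G U = 4) :
    (∃ T ⊆ U, T.Nontrivial ∧ cutSize G T = 3 ∧ (crossing M T).ncard = 1) ∨
      ∃ a b, M.Adj a b ∧ U ⊆ {a, b} := by
  by_contra! h
  obtain ⟨hsmall, hpair⟩ := h
  have hnear : ∀ a ∈ U, ∀ b, M.Adj a b →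
      ∃ X, IsNearBipartition G U X s(a, b) ∧ a ∉ X := by
    intro a ha b hab
    obtain ⟨X, ι, _, D, hD⟩ := hM.exists_isBarrier hUM hxe hxU hab ha
    have hB := hD.isTightBarrier hG hcut hU4
    refine ⟨X, hB.isNearBipartition fun i => not_nontrivial_iff.1 fun hi => ?_,
      (hB.pair_subset (.inl rfl)).2⟩
    exact hsmall (D i) ((hD.part_subset i).trans sdiff_subset) hi (hB.cutSize_eq_three i)
      (hB.ncard_crossing_eq_one hM.isPerfectMatching hUM i)
  have hpartner : ∀ p, ∃ q, M.Adj p q := fun p =>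
    (hM.isPerfectMatching.1 (hM.isPerfectMatching.2 p)).exists
  obtain ⟨a, ha⟩ := hU
  obtain ⟨b, hab⟩ := hpartner a
  obtain ⟨X, hX, -⟩ := hnear a ha b hab
  have hempty : ∀ y ∈ U, y ∉ X := by
    intro y hy
    obtain ⟨z, hyz⟩ := hpartner y
    obtain ⟨Y, hY, hyY⟩ := hnear y hy z hyz
    exact hX.unique hcut hY ⟨x, hxU⟩ ▸ hyY
  refine hpair a b hab fun p hp => ?_
  obtain ⟨q, hpq⟩ := hpartner p
  have hq := hUM p hp q hpq
  rcases Sym2.eq_iff.1 (hX.eq_of_adj p ⟨hp, hempty p hp⟩ q ⟨hq, hempty q hq⟩ hpq.adj_sub) with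
    ⟨rfl, -⟩ | ⟨rfl, -⟩
  exacts [Or.inl rfl, Or.inr rfl]

lemma cutSize_sdiff_singleton_eq_four (hG : IsCubic G) (hcut : IsThreeEdgeConnected G)
    (hS : cutSize G S = 3) (hnontrivial : S.Nontrivial) (hs : s ∈ crossing M S) :
    cutSize G (S \ {s}) = 4 ∧ edgeCount G {s} (S \ {s}) = 2 := by
  obtain ⟨hsS, r, hsr, hr⟩ := hs
  have hinsert := cutSize_insert (G := G) (p := s) (S := S \ {s}) fun h => h.2 rfl
  rw [insert_sdiff_self_of_mem hsS, hS, hG s] at hinsert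
  have hthree : 3 ≤ cutSize G (S \ {s}) := by
    obtain ⟨p, hp, hps⟩ := hnontrivial.exists_ne s
    exact hcut _ ⟨p, hp, hps⟩ ⟨s, fun h => h.2 rfl⟩
  have hlt : edgeCount G {s} (S \ {s}) < 3 := by
    rw [edgeCount_singleton_left, ← hG s]
    exact ncard_lt_ncard ⟨inter_subset_left, fun h => hr (h hsr.adj_sub).2.1⟩
  omega

theorem IsUniqueMatching.exists_triangle_of_cutSize_eq_three (hG : IsCubic G)
    (hcut : IsThreeEdgeConnected G) (hM : IsUniqueMatching M e) (hxe : x ∈ e) (hxS : x ∉ S)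
    (hnontrivial : S.Nontrivial) (hS : cutSize G S = 3) (hcross : (crossing M S).ncard = 1) :
    ∃ a b c, M.Adj a b ∧ G.Adj a c ∧ G.Adj b c := by
  induction hn : S.ncard using Nat.strong_induction_on generalizing S with | _ n ih
  obtain ⟨s, hs⟩ := ncard_eq_one.1 hcross
  have hsS : s ∈ crossing M S := hs ▸ mem_singleton s
  obtain ⟨hU4, hsU⟩ := cutSize_sdiff_singleton_eq_four hG hcut hS hnontrivial hsS
  have hU : (S \ {s}).Nonempty := by
    obtain ⟨p, hp, hps⟩ := hnontrivial.exists_ne s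
    exact ⟨p, hp, hps⟩
  rcases exists_cutSize_eq_three_or_subset_pair hG hcut hM hxe (fun h => hxS h.1)
    (mem_of_adj_of_crossing_eq_singleton hM.isPerfectMatching.1 hs) hU hU4 with
    ⟨T, hTS, hT, hT3, hTcross⟩ | ⟨a, b, hab, hsub⟩
  · have hlt : T.ncard < S.ncard :=
      (ncard_le_ncard hTS).trans_lt (ncard_sdiff_singleton_lt_of_mem hsS.1)
    exact ih _ (hn ▸ hlt) (fun h => hxS (hTS h).1) hT hT3 hTcross rfl
  · have hnbrs : G.neighborSet s ∩ (S \ {s}) = {a, b} := by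
      refine eq_of_subset_of_ncard_le (inter_subset_right.trans hsub) ?_
      rw [← edgeCount_singleton_left, hsU, ncard_pair hab.adj_sub.ne]
    have hends := pair_subset_iff.1 hnbrs.superset
    exact ⟨a, b, s, hab, hends.1.1.symm, hends.2.1.symm⟩

/-- The matching edge at an end `x` of the lonely edge is the only one that leaves the complement
of `x`, which is therefore a set to which the previous theorem applies. -/
theorem IsUniqueMatching.exists_triangle (hG : IsCubic G) (hcut : IsThreeEdgeConnected G)
    (hM : IsUniqueMatching M e) : ∃ a b c, M.Adj a b ∧ G.Adj a c ∧ G.Adj b c := by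
  obtain ⟨x, y⟩ := e
  have hxy : M.Adj x y := hM.mem_edgeSet
  have hnontrivial : ({x}ᶜ : Set V).Nontrivial := by
    obtain ⟨b, c, d, hbc, -, -, hN⟩ := ncard_eq_three.1 (hG x)
    have hsub : {b, c, d} ⊆ ({x}ᶜ : Set V) := hN ▸ fun p hp => (G.ne_of_adj hp).symm
    exact ⟨b, hsub (Or.inl rfl), c, hsub (Or.inr (Or.inl rfl)), hbc⟩
  refine hM.exists_triangle_of_cutSize_eq_three hG hcut (Sym2.mem_mk_left x y) (S := {x}ᶜ)
    (fun h => h rfl) hnontrivial (cutSize_compl.trans hG.cutSize_singleton) ?_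
  refine ncard_eq_one.2 ⟨y, ?_⟩
  ext p
  refine ⟨?_, ?_⟩
  · rintro ⟨-, q, hpq, hq⟩
    obtain rfl : q = x := by_contra hq
    exact hM.isPerfectMatching.1.eq_of_adj_left hpq.symm hxy
  · rintro rfl
    exact ⟨hxy.ne.symm, x, hxy.symm, fun h => h rfl⟩

end Triangle

section TriangleReplacement

variable {V : Type u} {G : SimpleGraph V} {v : V} {M : G.Subgraph}
  {N : (replaceByTriangle G v).Subgraph}

/-- The vertices of `replaceByTriangle G v`. -/
abbrev TriangleVertex (G : SimpleGraph V) (v : V) : Type u :=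
  {w : V // w ≠ v} ⊕ {x : V // G.Adj v x}

/-- The map that contracts the triangle of `replaceByTriangle G v` back to `v`. -/
def collapse : TriangleVertex G v → V :=
  Sum.elim Subtype.val fun _ => v

lemma adj_collapse {p q : TriangleVertex G v} (hpq : (replaceByTriangle G v).Adj p q)
    (hne : collapse p ≠ collapse q) : G.Adj (collapse p) (collapse q) := by
  rcases p with a | x <;> rcases q with b | y
  · exact hpq
  · have hay : a.1 = y.1 := hpq
    simpa only [collapse, Sum.elim_inl, Sum.elim_inr, hay] using y.2.symm
  · have hbx : b.1 = x.1 := hpq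
    simpa only [collapse, Sum.elim_inl, Sum.elim_inr, hbx] using x.2
  · exact absurd rfl hne

lemma exists_lift {a b : V} (hab : G.Adj a b) : ∃ p q : TriangleVertex G v,
    collapse p = a ∧ collapse q = b ∧ (replaceByTriangle G v).Adj p q := by
  by_cases ha : a = v
  · subst ha
    exact ⟨Sum.inr ⟨b, hab⟩, Sum.inl ⟨b, hab.ne'⟩, rfl, rfl, rfl⟩
  · by_cases hb : b = v
    · subst hb
      exact ⟨Sum.inl ⟨a, ha⟩, Sum.inr ⟨a, hab.symm⟩, rfl, rfl, rfl⟩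
    · exact ⟨Sum.inl ⟨a, ha⟩, Sum.inl ⟨b, hb⟩, rfl, rfl, hab⟩

lemma lift_left_unique {p q p' q' : TriangleVertex G v} (hpq : (replaceByTriangle G v).Adj p q)
    (hpq' : (replaceByTriangle G v).Adj p' q') (hne : collapse p ≠ collapse q)
    (hp : collapse p = collapse p') (hq : collapse q = collapse q') : p = p' := by
  rcases p with a | x <;> rcases p' with a' | x'
  · exact congrArg Sum.inl (Subtype.ext hp)
  · exact absurd hp a.2
  · exact absurd hp.symm a'.2
  · rcases q with b | y
    · rcases q' with b' | y'
      · have hx : b.1 = x.1 := hpq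
        have hx' : b'.1 = x'.1 := hpq'
        exact congrArg Sum.inr (Subtype.ext (hx.symm.trans (hq.trans hx')))
      · exact absurd hq b.2
    · exact absurd rfl hne

lemma lift_unique {p q p' q' : TriangleVertex G v} (hpq : (replaceByTriangle G v).Adj p q)
    (hpq' : (replaceByTriangle G v).Adj p' q') (hne : collapse p ≠ collapse q)
    (hp : collapse p = collapse p') (hq : collapse q = collapse q') : p = p' ∧ q = q' :=
  ⟨lift_left_unique hpq hpq' hne hp hq, lift_left_unique hpq.symm hpq'.symm hne.symm hq hp⟩

/-- The image of a subgraph of `replaceByTriangle G v` under the contraction of the triangle. -/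
def shrink (N : (replaceByTriangle G v).Subgraph) : G.Subgraph where
  verts := univ
  Adj a b := a ≠ b ∧ ∃ p q, collapse p = a ∧ collapse q = b ∧ N.Adj p q
  adj_sub := by
    rintro _ _ ⟨hne, p, q, rfl, rfl, hpq⟩
    exact adj_collapse hpq.adj_sub hne
  edge_vert _ := mem_univ _
  symm := ⟨fun _ _ ⟨hne, p, q, hp, hq, hpq⟩ => ⟨hne.symm, q, p, hq, hp, hpq.symm⟩⟩

/-- The subgraph of `replaceByTriangle G v` that has the edges of `M` and all the triangle edges
between new vertices not covered by these. It is a perfect matching if `M` is a perfect matching or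
a `v`-join and `v` has degree 3. -/
def expand (M : G.Subgraph) (v : V) : (replaceByTriangle G v).Subgraph where
  verts := univ
  Adj
    | Sum.inl a, Sum.inl b => M.Adj a.1 b.1
    | Sum.inl a, Sum.inr x => a.1 = x.1 ∧ M.Adj v x.1
    | Sum.inr x, Sum.inl a => a.1 = x.1 ∧ M.Adj v x.1
    | Sum.inr x, Sum.inr y => x ≠ y ∧ ¬ M.Adj v x.1 ∧ ¬ M.Adj v y.1
  adj_sub := by
    rintro (a | x) (b | y) h
    exacts [M.adj_sub h, h.1, h.1, h.1]
  edge_vert _ := mem_univ _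
  symm := ⟨by
    rintro (a | x) (b | y) h
    exacts [M.symm.symm _ _ h, h, h, ⟨h.1.symm, h.2.2, h.2.1⟩]⟩

lemma shrink_adj_iff {p q : TriangleVertex G v} (hpq : (replaceByTriangle G v).Adj p q)
    (hne : collapse p ≠ collapse q) : (shrink N).Adj (collapse p) (collapse q) ↔ N.Adj p q := by
  refine ⟨?_, fun h => ⟨hne, p, q, rfl, rfl, h⟩⟩
  rintro ⟨-, p', q', hp, hq, h⟩
  obtain ⟨rfl, rfl⟩ := lift_unique hpq h.adj_sub hne hp.symm hq.symm
  exact h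

lemma shrink_adj_apex_iff {x : {x : V // G.Adj v x}} :
    (shrink N).Adj v x ↔ N.Adj (Sum.inr x) (Sum.inl ⟨x, x.2.ne'⟩) :=
  shrink_adj_iff (p := Sum.inr x) (q := Sum.inl ⟨x, x.2.ne'⟩) rfl x.2.ne

lemma expand_adj_iff {p q : TriangleVertex G v} (hpq : (replaceByTriangle G v).Adj p q)
    (hne : collapse p ≠ collapse q) : (expand M v).Adj p q ↔ M.Adj (collapse p) (collapse q) := by
  rcases p with a | x <;> rcases q with b | y
  · rfl
  · have hay : a.1 = y.1 := hpq
    exact (and_iff_right hay).trans (by rw [M.adj_comm]; exact hay ▸ Iff.rfl)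
  · have hbx : b.1 = x.1 := hpq
    exact (and_iff_right hbx).trans (hbx ▸ Iff.rfl)
  · exact absurd rfl hne

lemma shrink_expand (hM : M.IsSpanning) : shrink (expand M v) = M := by
  refine Subgraph.ext (hM.verts_eq_univ.symm) ?_
  ext a b
  refine ⟨?_, fun hab => ?_⟩
  · rintro ⟨hne, p, q, rfl, rfl, hpq⟩
    exact (expand_adj_iff hpq.adj_sub hne).1 hpq
  · obtain ⟨p, q, rfl, rfl, hpq⟩ := exists_lift (v := v) hab.adj_sub
    exact (shrink_adj_iff hpq hab.ne).2 ((expand_adj_iff hpq hab.ne).2 hab)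

lemma ncard_neighborSet_shrink (a : {w : V // w ≠ v}) :
    ((shrink N).neighborSet a).ncard = (N.neighborSet (Sum.inl a)).ncard := by
  have hne : ∀ {q}, N.Adj (Sum.inl a) q → a.1 ≠ collapse q := by
    rintro (b | y) h
    exacts [fun hab => h.ne (congrArg Sum.inl (Subtype.ext hab)), a.2]
  refine (ncard_congr (fun q _ => collapse q) (fun q hq => ?_) (fun q q' hq hq' h => ?_) ?_).symm
  · exact ⟨hne hq, Sum.inl a, q, rfl, rfl, hq⟩
  · exact (lift_unique hq.adj_sub hq'.adj_sub (hne hq) rfl h).2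
  · rintro _ ⟨-, p, q, hp, rfl, hpq⟩
    rcases p with a' | x
    · obtain rfl : a' = a := Subtype.ext hp
      exact ⟨q, hpq, rfl⟩
    · exact absurd hp.symm a.2

lemma ncard_neighborSet_expand_inl (hM : M.IsSpanning) (a : {w : V // w ≠ v}) :
    ((expand M v).neighborSet (Sum.inl a)).ncard = (M.neighborSet a).ncard := by
  rw [← ncard_neighborSet_shrink, shrink_expand hM]

end TriangleReplacement

section TriangleMatching

variable {V : Type u} {G : SimpleGraph V} {v : V} {M : G.Subgraph}
  {N : (replaceByTriangle G v).Subgraph}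

lemma exists_ne_ne_of_card_eq_three {α : Type*} (hα : Nat.card α = 3) (x y : α) :
    ∃ z, z ≠ x ∧ z ≠ y := by
  have hlt : ({x, y} : Set α).ncard < (univ : Set α).ncard := by
    rw [ncard_univ, hα]
    exact (ncard_insert_le x {y}).trans_lt (by rw [ncard_singleton]; norm_num)
  obtain ⟨z, -, hz⟩ := exists_mem_notMem_of_ncard_lt_ncard hlt
  exact ⟨z, fun h => hz (.inl h), fun h => hz (.inr h)⟩

lemma eq_or_eq_or_eq_of_card_eq_three {α : Type*} (hα : Nat.card α = 3) {x y z : α}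
    (hxy : x ≠ y) (hxz : x ≠ z) (hyz : y ≠ z) (t : α) : t = x ∨ t = y ∨ t = z := by
  have : Finite α := Nat.finite_of_card_ne_zero (by omega)
  have h : ({x, y, z} : Set α) = univ := eq_of_subset_of_ncard_le (subset_univ _) (by
    rw [ncard_univ, hα, ncard_eq_three.2 ⟨x, y, z, hxy, hxz, hyz, rfl⟩])
  exact h.ge (mem_univ t)

lemma neighborSet_eq_of_ncard_eq_three (hv : Nat.card {x // G.Adj v x} = 3)
    (hM : (M.neighborSet v).ncard = 3) : M.neighborSet v = G.neighborSet v :=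
  have : Finite (G.neighborSet v) := Nat.finite_of_card_ne_zero (hv.trans_ne three_ne_zero)
  eq_of_subset_of_ncard_le (M.neighborSet_subset v) (hM ▸ hv.le) (toFinite (G.neighborSet v))

lemma isPerfectMatching_expand_of_ncard_neighborSet (hv : Nat.card {x // G.Adj v x} = 3)
    (hM : M.IsSpanning) (hdeg : ∀ w, w ≠ v → (M.neighborSet w).ncard = 1)
    (hdeg_v : (M.neighborSet v).ncard = 1 ∨ (M.neighborSet v).ncard = 3) :
    (expand M v).IsPerfectMatching := by
  refine isPerfectMatching_iff_forall_ncard.2 ?_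
  rintro (a | x)
  · rw [ncard_neighborSet_expand_inl hM, hdeg a a.2]
  refine ncard_eq_one.2 ?_
  by_cases hx : M.Adj v x
  · refine ⟨Sum.inl ⟨x, x.2.ne'⟩, eq_singleton_iff_unique_mem.2 ⟨⟨rfl, hx⟩, ?_⟩⟩
    rintro (a | y) h
    exacts [congrArg Sum.inl (Subtype.ext h.1), absurd hx h.2.1]
  · have hdeg_one : (M.neighborSet v).ncard = 1 := hdeg_v.resolve_right fun h => hx <|
      (neighborSet_eq_of_ncard_eq_three hv h).ge x.2
    obtain ⟨y, hy⟩ := ncard_eq_one.1 hdeg_one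
    have hvy : M.Adj v y := hy.ge rfl
    set y' : {x // G.Adj v x} := ⟨y, hvy.adj_sub⟩
    have hxy : x ≠ y' := fun h => hx (h ▸ hvy)
    have hfree : ∀ t : {x // G.Adj v x}, t ≠ y' → ¬ M.Adj v t := fun t ht h =>
      ht (Subtype.ext (hy.le h))
    obtain ⟨z, hzx, hzy⟩ := exists_ne_ne_of_card_eq_three hv x y'
    refine ⟨Sum.inr z, eq_singleton_iff_unique_mem.2 ⟨⟨hzx.symm, hx, hfree z hzy⟩, ?_⟩⟩
    rintro (a | t) h
    · exact absurd h.2 hx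
    · rcases eq_or_eq_or_eq_of_card_eq_three hv hxy hzx.symm hzy.symm t with rfl | rfl | rfl
      exacts [absurd rfl h.1, absurd hvy h.2.2, rfl]

lemma isPerfectMatching_expand (hv : Nat.card {x // G.Adj v x} = 3)
    (hM : M.IsPerfectMatching) : (expand M v).IsPerfectMatching :=
  have hdeg := isPerfectMatching_iff_forall_ncard.1 hM
  isPerfectMatching_expand_of_ncard_neighborSet hv hM.2 (fun w _ => hdeg w) (.inl (hdeg v))

lemma IsJoin.isPerfectMatching_expand (hv : Nat.card {x // G.Adj v x} = 3)
    (hM : IsJoin v M) : (expand M v).IsPerfectMatching :=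
  isPerfectMatching_expand_of_ncard_neighborSet hv hM.1 hM.2.2 (.inr hM.2.1)

lemma shrink_adj_apex_iff_forall_not_adj (hN : N.IsPerfectMatching) {x : {x // G.Adj v x}} :
    (shrink N).Adj v x ↔ ∀ y, ¬ N.Adj (Sum.inr x) (Sum.inr y) := by
  rw [shrink_adj_apex_iff]
  refine ⟨fun h y hy => Sum.inl_ne_inr (hN.1.eq_of_adj_left h hy), fun h => ?_⟩
  obtain ⟨a | y, ha, -⟩ := Subgraph.isPerfectMatching_iff.1 hN (Sum.inr x)
  · obtain rfl : a = ⟨x, x.2.ne'⟩ := Subtype.ext ha.adj_sub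
    exact ha
  · exact absurd ha (h y)

lemma expand_shrink (hv : Nat.card {x // G.Adj v x} = 3) (hN : N.IsPerfectMatching) :
    expand (shrink N) v = N := by
  have hcross : ∀ {p q}, collapse p ≠ collapse q → ((expand (shrink N) v).Adj p q ↔ N.Adj p q) := by
    intro p q hne
    by_cases hpq : (replaceByTriangle G v).Adj p q
    · exact (expand_adj_iff hpq hne).trans (shrink_adj_iff hpq hne)
    · exact iff_of_false (fun h => hpq h.adj_sub) fun h => hpq h.adj_sub
  have htri : ∀ x y : {x // G.Adj v x}, (expand (shrink N) v).Adj (Sum.inr x) (Sum.inr y) ↔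
      N.Adj (Sum.inr x) (Sum.inr y) := by
    intro x y
    change (x ≠ y ∧ ¬ (shrink N).Adj v x ∧ ¬ (shrink N).Adj v y) ↔ _
    simp only [shrink_adj_apex_iff_forall_not_adj hN, not_forall, not_not]
    refine ⟨?_, fun h => ⟨h.adj_sub, ⟨y, h⟩, x, h.symm⟩⟩
    rintro ⟨hxy, ⟨x', hx⟩, y', hy⟩
    by_contra hxy'
    have hx' : x' ≠ y := fun h => hxy' (h ▸ hx)
    have hxx' : x ≠ x' := hx.adj_sub
    rcases eq_or_eq_or_eq_of_card_eq_three hv hxy hxx' hx'.symm y' with rfl | rfl | rfl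
    · exact hxy' hy.symm
    · exact hy.ne rfl
    · exact hxy (Sum.inr_injective (hN.1.eq_of_adj_right hx hy))
  refine Subgraph.ext hN.2.verts_eq_univ.symm ?_
  ext (a | x) (b | y)
  · by_cases hab : a = b
    · subst hab
      exact iff_of_false (fun h => h.ne rfl) fun h => h.ne rfl
    · exact hcross fun h => hab (Subtype.ext h)
  · exact hcross a.2
  · exact hcross b.2.symm
  · exact htri x y

lemma neighborSet_shrink_of_adj (hv : Nat.card {x // G.Adj v x} = 3) (hN : N.IsPerfectMatching)
    {x y z : {x // G.Adj v x}} (hyz : N.Adj (Sum.inr y) (Sum.inr z)) (hxy : x ≠ y) (hxz : x ≠ z) :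
    (shrink N).neighborSet v = {x.1} := by
  have hyz' : y ≠ z := hyz.adj_sub
  have hmem : ∀ t : {x // G.Adj v x}, (shrink N).Adj v t ↔ t = x := by
    intro t
    rw [shrink_adj_apex_iff_forall_not_adj hN]
    refine ⟨fun h => ?_, ?_⟩
    · rcases eq_or_eq_or_eq_of_card_eq_three hv hxy hxz hyz' t with rfl | rfl | rfl
      exacts [rfl, absurd hyz (h z), absurd hyz.symm (h y)]
    · rintro rfl s hs
      rcases eq_or_eq_or_eq_of_card_eq_three hv hxy hxz hyz' s with rfl | rfl | rfl
      · exact hs.ne rfl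
      · exact hxz (Sum.inr_injective (hN.1.eq_of_adj_right hs hyz.symm))
      · exact hxy (Sum.inr_injective (hN.1.eq_of_adj_right hs hyz))
  exact eq_singleton_iff_unique_mem.2
    ⟨(hmem x).2 rfl, fun t ht =>
      congrArg Subtype.val ((hmem ⟨t, (shrink N).neighborSet_subset v ht⟩).1 ht)⟩

lemma isPerfectMatching_shrink (hv : Nat.card {x // G.Adj v x} = 3) (hN : N.IsPerfectMatching)
    {y z : {x // G.Adj v x}} (hyz : N.Adj (Sum.inr y) (Sum.inr z)) :
    (shrink N).IsPerfectMatching := by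
  refine isPerfectMatching_iff_forall_ncard.2 fun w => ?_
  by_cases hw : w = v
  · obtain ⟨x, hxy, hxz⟩ := exists_ne_ne_of_card_eq_three hv y z
    rw [hw, neighborSet_shrink_of_adj hv hN hyz hxy hxz, ncard_singleton]
  · exact (ncard_neighborSet_shrink ⟨w, hw⟩).trans (isPerfectMatching_iff_forall_ncard.1 hN _)

lemma isJoin_shrink (hv : Nat.card {x // G.Adj v x} = 3) (hN : N.IsPerfectMatching)
    (hfree : ∀ y z, ¬ N.Adj (Sum.inr y) (Sum.inr z)) : IsJoin v (shrink N) := by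
  have hall : (shrink N).neighborSet v = G.neighborSet v :=
    ((shrink N).neighborSet_subset v).antisymm fun x hx =>
      (shrink_adj_apex_iff_forall_not_adj hN (x := ⟨x, hx⟩)).2 (hfree _)
  exact ⟨fun _ => mem_univ _, by rw [hall]; exact hv, fun w hw =>
    (ncard_neighborSet_shrink ⟨w, hw⟩).trans (isPerfectMatching_iff_forall_ncard.1 hN _)⟩

lemma exists_isLonely_replaceByTriangle_of_mem (hv : Nat.card {x // G.Adj v x} = 3) {e : Sym2 V}
    (he : IsLonely G e) (hve : v ∈ e) : ∃ f, IsLonely (replaceByTriangle G v) f := by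
  obtain ⟨M, hM⟩ := isLonely_iff.1 he
  obtain ⟨x, rfl⟩ := hve
  have hvx : M.Adj v x := hM.mem_edgeSet
  set x' : {x // G.Adj v x} := ⟨x, hvx.adj_sub⟩
  obtain ⟨y, hyx, -⟩ := exists_ne_ne_of_card_eq_three hv x' x'
  obtain ⟨z, hzx, hzy⟩ := exists_ne_ne_of_card_eq_three hv x' y
  have hfree : ∀ t : {x // G.Adj v x}, t ≠ x' → ¬ M.Adj v t := fun t ht h =>
    ht (Subtype.ext (hM.isPerfectMatching.1.eq_of_adj_left h hvx))
  refine ⟨s(Sum.inr y, Sum.inr z), isLonely_iff.2 ⟨expand M v,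
    isPerfectMatching_expand hv hM.isPerfectMatching, ⟨hzy.symm, hfree y hyx, hfree z hzx⟩, ?_⟩⟩
  intro N hN (hyz : N.Adj _ _)
  have hx : (shrink N).neighborSet v = {x} :=
    neighborSet_shrink_of_adj hv hN hyz hyx.symm hzx.symm
  rw [← hM.eq_of_mem_edgeSet (shrink N) (isPerfectMatching_shrink hv hN hyz) (hx.ge rfl),
    expand_shrink hv hN]

lemma exists_isLonely_replaceByTriangle_of_not_exists_isJoin
    (hv : Nat.card {x // G.Adj v x} = 3) {e : Sym2 V} (he : IsLonely G e)
    (hjoin : ¬ ∃ J : G.Subgraph, IsJoin v J ∧ e ∈ J.edgeSet) :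
    ∃ f, IsLonely (replaceByTriangle G v) f := by
  obtain ⟨M, hM⟩ := isLonely_iff.1 he
  induction e with | h a b
  have hab : M.Adj a b := hM.mem_edgeSet
  obtain ⟨p, q, rfl, rfl, hpq⟩ := exists_lift (v := v) hab.adj_sub
  refine ⟨s(p, q), isLonely_iff.2 ⟨expand M v, isPerfectMatching_expand hv hM.isPerfectMatching,
    (expand_adj_iff hpq hab.ne).2 hab, ?_⟩⟩
  intro N hN hpqN
  have hmem : s(collapse p, collapse q) ∈ (shrink N).edgeSet := (shrink_adj_iff hpq hab.ne).2 hpqN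
  obtain ⟨y, z, hyz⟩ : ∃ y z, N.Adj (Sum.inr y) (Sum.inr z) := by
    by_contra! hfree
    exact hjoin ⟨shrink N, isJoin_shrink hv hN hfree, hmem⟩
  rw [← hM.eq_of_mem_edgeSet (shrink N) (isPerfectMatching_shrink hv hN hyz) hmem,
    expand_shrink hv hN]

lemma isUniqueMatching_shrink (hv : Nat.card {x // G.Adj v x} = 3) {f : Sym2 (TriangleVertex G v)}
    (hN : IsUniqueMatching N f) {y z : {x // G.Adj v x}} (hyz : N.Adj (Sum.inr y) (Sum.inr z))
    {e : Sym2 V} (he : e ∈ (shrink N).edgeSet)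
    (hf : ∀ M : G.Subgraph, M.IsPerfectMatching → e ∈ M.edgeSet → f ∈ (expand M v).edgeSet) :
    IsUniqueMatching (shrink N) e where
  isPerfectMatching := isPerfectMatching_shrink hv hN.isPerfectMatching hyz
  mem_edgeSet := he
  eq_of_mem_edgeSet M hM heM := by
    rw [← hN.eq_of_mem_edgeSet _ (isPerfectMatching_expand hv hM) (hf M hM heM),
      shrink_expand hM.2]

lemma exists_isLonely_of_isUniqueMatching_replaceByTriangle
    (hv : Nat.card {x // G.Adj v x} = 3) {f : Sym2 (TriangleVertex G v)}
    (hN : IsUniqueMatching N f) {y z : {x // G.Adj v x}} (hyz : N.Adj (Sum.inr y) (Sum.inr z)) :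
    ∃ e, IsLonely G e ∧ (v ∈ e ∨ ¬ ∃ J : G.Subgraph, IsJoin v J ∧ e ∈ J.edgeSet) := by
  induction f with | h p q
  have hpq : N.Adj p q := hN.mem_edgeSet
  by_cases hne : collapse p = collapse q
  · obtain ⟨y', z', rfl, rfl⟩ : ∃ y' z', p = Sum.inr y' ∧ q = Sum.inr z' := by
      rcases p with a | y' <;> rcases q with b | z'
      exacts [absurd (congrArg Sum.inl (Subtype.ext hne)) hpq.ne, absurd hne a.2,
        absurd hne.symm b.2, ⟨y', z', rfl, rfl⟩]
    obtain ⟨x, hxy, hxz⟩ := exists_ne_ne_of_card_eq_three hv y' z'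
    have hx := neighborSet_shrink_of_adj hv hN.isPerfectMatching hpq hxy hxz
    refine ⟨s(v, x), isLonely_iff.2 ⟨_, isUniqueMatching_shrink hv hN hpq (hx.ge rfl) ?_⟩,
      .inl (Sym2.mem_mk_left v x)⟩
    intro M hM (hvx : M.Adj v x)
    have hfree : ∀ t : {x // G.Adj v x}, x ≠ t → ¬ M.Adj v t := fun t ht h =>
      ht (Subtype.ext (hM.1.eq_of_adj_left hvx h))
    exact ⟨hpq.adj_sub, hfree y' hxy, hfree z' hxz⟩
  · refine ⟨s(collapse p, collapse q), isLonely_iff.2 ⟨_, isUniqueMatching_shrink hv hN hyz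
      ((shrink_adj_iff hpq.adj_sub hne).2 hpq) fun M _ => (expand_adj_iff hpq.adj_sub hne).2⟩,
      .inr ?_⟩
    rintro ⟨J, hJ, hpqJ⟩
    have hJN : expand J v = N := hN.eq_of_mem_edgeSet _ (hJ.isPerfectMatching_expand hv)
      ((expand_adj_iff hpq.adj_sub hne).2 hpqJ)
    have hy : ¬ J.Adj v y := (hJN ▸ hyz : (expand J v).Adj (Sum.inr y) (Sum.inr z)).2.1
    exact hy ((neighborSet_eq_of_ncard_eq_three hv hJ.2.1).ge y.2)

end TriangleMatching

section TriangleConnectivity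

variable {V : Type u} {G : SimpleGraph V} {v : V}

lemma ncard_neighborSet_inl (a : {w : V // w ≠ v}) :
    ((replaceByTriangle G v).neighborSet (Sum.inl a)).ncard = (G.neighborSet a).ncard := by
  have htop : (shrink (⊤ : (replaceByTriangle G v).Subgraph)).neighborSet a = G.neighborSet a := by
    refine (Subgraph.neighborSet_subset _ _).antisymm fun b (hb : G.Adj a b) => ?_
    obtain ⟨p, q, hp, hq, hpq⟩ := exists_lift (v := v) hb
    exact ⟨hb.ne, p, q, hp, hq, hpq⟩
  rw [← htop, ncard_neighborSet_shrink]
  rfl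

lemma ncard_neighborSet_inr [Finite V] (x : {x // G.Adj v x}) :
    ((replaceByTriangle G v).neighborSet (Sum.inr x)).ncard = (G.neighborSet v).ncard := by
  have hnbr : (replaceByTriangle G v).neighborSet (Sum.inr x) =
      insert (Sum.inl ⟨x, x.2.ne'⟩) (Sum.inr '' {x}ᶜ) := by
    ext (a | y)
    · exact ⟨fun h => .inl (congrArg Sum.inl (Subtype.ext h)), fun h =>
        congrArg Subtype.val (Sum.inl_injective (h.resolve_right fun ⟨_, _, h⟩ => nomatch h))⟩
    · refine ⟨fun h => .inr ⟨y, Ne.symm h, rfl⟩, ?_⟩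
      rintro (h | ⟨t, ht, h⟩)
      · exact nomatch h
      · obtain rfl : t = y := Sum.inr_injective h
        exact Ne.symm ht
  have hcompl := ncard_add_ncard_compl {x}
  rw [ncard_singleton] at hcompl
  rw [hnbr, ncard_insert_of_notMem (by simp), ncard_image_of_injective _ Sum.inr_injective,
    add_comm, hcompl]
  rfl

lemma isCubic_replaceByTriangle_iff [Finite V] (hv : (G.neighborSet v).Nonempty) :
    IsCubic (replaceByTriangle G v) ↔ IsCubic G := by
  refine ⟨fun h w => ?_, fun h => ?_⟩
  · by_cases hw : w = v
    · obtain ⟨x, hx⟩ := hv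
      rw [hw, ← h (Sum.inr ⟨x, hx⟩), ncard_neighborSet_inr]
    · rw [← h (Sum.inl ⟨w, hw⟩), ncard_neighborSet_inl]
  · rintro (a | x)
    exacts [(ncard_neighborSet_inl a).trans (h a), (ncard_neighborSet_inr x).trans (h v)]

lemma collapse_surjective (hv : (G.neighborSet v).Nonempty) :
    Surjective (collapse : TriangleVertex G v → V) := by
  intro w
  by_cases hw : w = v
  · obtain ⟨x, hx⟩ := hv
    exact ⟨Sum.inr ⟨x, hx⟩, hw.symm⟩
  · exact ⟨Sum.inl ⟨w, hw⟩, rfl⟩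

lemma cutSize_preimage_collapse (S : Set V) :
    cutSize (replaceByTriangle G v) (collapse ⁻¹' S) = cutSize G S := by
  have hne : ∀ {p q : TriangleVertex G v}, collapse p ∈ S → collapse q ∉ S →
      collapse p ≠ collapse q := fun hp hq h => hq (h ▸ hp)
  refine ncard_congr (fun r _ => (collapse r.1, collapse r.2)) ?_ ?_ ?_
  · rintro r ⟨hp, hq, hpq⟩
    exact ⟨hp, hq, adj_collapse hpq (hne hp hq)⟩
  · rintro r r' ⟨hp, hq, hpq⟩ ⟨-, -, hpq'⟩ h
    obtain ⟨h₁, h₂⟩ := Prod.mk.inj h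
    exact Prod.ext_iff.2 (lift_unique hpq hpq' (hne hp hq) h₁ h₂)
  · rintro ⟨a, b⟩ ⟨ha, hb, hab⟩
    obtain ⟨p, q, rfl, rfl, hpq⟩ := exists_lift (v := v) hab
    exact ⟨(p, q), ⟨ha, hb, hpq⟩, rfl⟩

variable [Finite V]

lemma IsThreeEdgeConnected.three_le_cutSize_of_subsingleton (hcut : IsThreeEdgeConnected G)
    (hv : Nat.card {x // G.Adj v x} = 3) {S : Set (TriangleVertex G v)} (hS : S.Nonempty)
    (hsub : (Sum.inr ⁻¹' S).Subsingleton) : 3 ≤ cutSize (replaceByTriangle G v) S := by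
  set B : Set V := {w | ∃ h : w ≠ v, Sum.inl ⟨w, h⟩ ∈ S}
  set S₀ : Set (TriangleVertex G v) := collapse ⁻¹' B
  have hvB : v ∉ B := fun ⟨h, _⟩ => h rfl
  have hB : S₀.Nonempty → 3 ≤ cutSize (replaceByTriangle G v) S₀ := by
    rintro ⟨p, hp⟩
    rw [cutSize_preimage_collapse]
    exact hcut B ⟨_, hp⟩ ⟨v, hvB⟩
  by_cases hempty : ∃ x, Sum.inr x ∈ S
  · obtain ⟨x, hx⟩ := hempty
    have hxS : Sum.inr x ∉ S₀ := hvB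
    have hSx : S = insert (Sum.inr x) S₀ := by
      ext (a | y)
      · exact ⟨fun h => .inr ⟨a.2, h⟩, fun h => (h.resolve_left Sum.inl_ne_inr).2⟩
      · exact ⟨fun h => .inl (congrArg Sum.inr (hsub h hx)),
          fun h => (h.resolve_right hvB) ▸ hx⟩
    have hinsert := cutSize_insert (G := replaceByTriangle G v) hxS
    rw [ncard_neighborSet_inr, show (G.neighborSet v).ncard = 3 from hv, ← hSx,
      edgeCount_singleton_left] at hinsert
    rcases S₀.eq_empty_or_nonempty with h₀ | h₀
    · rw [h₀, inter_empty, ncard_empty] at hinsert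
      omega
    · have hle : ((replaceByTriangle G v).neighborSet (Sum.inr x) ∩ S₀).ncard ≤ 1 := by
        refine (ncard_le_ncard ?_).trans_eq (ncard_singleton (Sum.inl ⟨x.1, x.2.ne'⟩))
        rintro (a | y) ⟨h, hS₀⟩
        exacts [congrArg Sum.inl (Subtype.ext h), absurd hS₀ hvB]
      have := hB h₀
      omega
  · have hS₀ : S = S₀ := by
      ext (a | y)
      · exact ⟨fun h => ⟨a.2, h⟩, fun h => h.2⟩
      · exact ⟨fun h => absurd ⟨y, h⟩ hempty, fun h => absurd h hvB⟩
    exact hS₀ ▸ hB (hS₀ ▸ hS)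

lemma isThreeEdgeConnected_replaceByTriangle_iff (hv : Nat.card {x // G.Adj v x} = 3) :
    IsThreeEdgeConnected (replaceByTriangle G v) ↔ IsThreeEdgeConnected G := by
  refine ⟨fun hcut S hS hSc => ?_, fun hcut S hS hSc => ?_⟩
  · rw [← cutSize_preimage_collapse (v := v)]
    have hsurj : Surjective (collapse : TriangleVertex G v → V) :=
      collapse_surjective (nonempty_of_ncard_ne_zero (hv.trans_ne three_ne_zero))
    exact hcut _ (hS.preimage hsurj) (hSc.preimage hsurj)
  · by_cases hsub : (Sum.inr ⁻¹' S).Subsingleton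
    · exact hcut.three_le_cutSize_of_subsingleton hv hS hsub
    · obtain ⟨x, hx, y, hy, hxy⟩ := not_subsingleton_iff.1 hsub
      rw [← cutSize_compl]
      refine hcut.three_le_cutSize_of_subsingleton hv hSc fun z hz t ht => ?_
      by_contra hzt
      have hxz : x ≠ z := by rintro rfl; exact hz hx
      have hyz : y ≠ z := by rintro rfl; exact hz hy
      rcases eq_or_eq_or_eq_of_card_eq_three hv hxy hxz hyz t with rfl | rfl | rfl
      exacts [ht hx, ht hy, hzt rfl]

end TriangleConnectivity

section Contraction

variable {V : Type u} {G : SimpleGraph V} {T : Set V} {t : V}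

/-- The graph obtained from `G` by contracting `T` to the single vertex `none`; parallel edges are
merged. -/
def contract (G : SimpleGraph V) (T : Set V) : SimpleGraph (Option ↥Tᶜ) where
  Adj
    | some a, some b => G.Adj a b
    | none, some b => ∃ t ∈ T, G.Adj t b
    | some a, none => ∃ t ∈ T, G.Adj t a
    | none, none => False
  symm := ⟨by
    rintro (_ | a) (_ | b) h
    exacts [h, h, h, h.symm]⟩
  loopless := ⟨by
    rintro (_ | a) h
    exacts [h, G.loopless.irrefl _ h]⟩

/-- Here `o t` is the only neighbour of `t` outside `T`. -/
lemma exists_iso_replaceByTriangle_contract (hT : G.IsClique T) {o : T → ↥Tᶜ} (ho : Injective o)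
    (hadj : ∀ (t : T) (w : ↥Tᶜ), G.Adj t w ↔ w = o t) :
    ∃ φ : G ≃g replaceByTriangle (contract G T) none, ∀ t ∈ T, ∃ x, φ t = Sum.inr x := by
  classical
  let newVertex (t : T) : {x // (contract G T).Adj none x} :=
    ⟨some (o t), t, t.2, (hadj t (o t)).2 rfl⟩
  let oldVertex (w : ↥Tᶜ) : {w : Option ↥Tᶜ // w ≠ none} := ⟨some w, Option.some_ne_none w⟩
  have hnew : Bijective newVertex := by
    refine ⟨fun s t h => ho (Option.some_injective _ (congrArg Subtype.val h)), ?_⟩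
    rintro ⟨_ | w, hw⟩
    · exact hw.elim
    · obtain ⟨t, ht, htw⟩ := hw
      exact ⟨⟨t, ht⟩, Subtype.ext (congrArg some ((hadj ⟨t, ht⟩ w).1 htw).symm)⟩
  have hold : Bijective oldVertex := by
    refine ⟨fun a b h => Option.some_injective _ (congrArg Subtype.val h), ?_⟩
    rintro ⟨_ | w, hw⟩
    exacts [absurd rfl hw, ⟨w, rfl⟩]
  let E : T ⊕ ↥Tᶜ ≃ TriangleVertex (contract G T) none :=
    (Equiv.sumCongr (.ofBijective _ hnew) (.ofBijective _ hold)).trans (Equiv.sumComm _ _)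
  have hE : ∀ p q, (replaceByTriangle (contract G T) none).Adj (E p) (E q) ↔
      G.Adj (Equiv.Set.sumCompl T p) (Equiv.Set.sumCompl T q) := by
    rintro (s | a) (t | b)
    · exact hnew.1.ne_iff.trans ⟨fun h => hT s.2 t.2 (Subtype.coe_injective.ne h),
        fun h hst => h.ne (congrArg Subtype.val hst)⟩
    · exact (Option.some_injective _).eq_iff.trans (hadj s b).symm
    · exact (Option.some_injective _).eq_iff.trans ((hadj t a).symm.trans (G.adj_comm _ _))
    · rfl
  refine ⟨⟨(Equiv.Set.sumCompl T).symm.trans E, fun {u w} => ?_⟩,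
    fun t ht => ⟨newVertex ⟨t, ht⟩, ?_⟩⟩
  · simpa using hE ((Equiv.Set.sumCompl T).symm u) ((Equiv.Set.sumCompl T).symm w)
  · exact congrArg E (Equiv.Set.sumCompl_symm_apply_of_mem ht)

variable [Finite V]

lemma IsCubic.ncard_neighborSet_inter_compl_of_isClique (hG : IsCubic G) (hT : G.IsClique T)
    (hcard : T.ncard = 3) (ht : t ∈ T) : (G.neighborSet t ∩ Tᶜ).ncard = 1 := by
  have hinter : G.neighborSet t ∩ T = T \ {t} := by
    ext s
    exact ⟨fun h => ⟨h.2, G.ne_of_adj h.1.symm⟩, fun h => ⟨hT ht h.1 (Ne.symm h.2), h.1⟩⟩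
  have hsum := ncard_inter_add_ncard_sdiff_eq_ncard (G.neighborSet t) T
  rw [hinter, ncard_sdiff_singleton_of_mem ht, hcard, hG t, sdiff_eq] at hsum
  omega

/-- A common outside neighbour of two vertices of the triangle would leave an edge cut of size
less than three when added to the triangle. -/
theorem IsThreeEdgeConnected.exists_iso_replaceByTriangle_contract (hcut : IsThreeEdgeConnected G)
    (hG : IsCubic G) (hV : 4 < Nat.card V) (hT : G.IsClique T) (hcard : T.ncard = 3) :
    ∃ φ : G ≃g replaceByTriangle (contract G T) none, ∀ t ∈ T, ∃ x, φ t = Sum.inr x := by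
  have hone : ∀ t ∈ T, (G.neighborSet t ∩ Tᶜ).ncard = 1 := fun t =>
    hG.ncard_neighborSet_inter_compl_of_isClique hT hcard
  choose o ho using fun t : T => ncard_eq_one.1 (hone t t.2)
  have hmem : ∀ t : T, G.Adj t (o t) ∧ o t ∈ Tᶜ := fun t => (ho t).ge rfl
  have hcutT : cutSize G T ≤ 1 * T.ncard := edgeCount_le_mul_ncard fun t ht => by
    rw [edgeCount_singleton_left, hone t ht]
  refine CubicGraph.exists_iso_replaceByTriangle_contract hT (o := fun t => ⟨o t, (hmem t).2⟩)
    (fun s t hst => ?_) fun t w => ?_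
  · by_contra hne
    have host : o s = o t := congrArg Subtype.val hst
    have hlt := hG.cutSize_insert_lt (hmem s).2 (hmem s).1.symm (host ▸ (hmem t).1.symm)
      (Subtype.coe_injective.ne hne) s.2 t.2
    have hthree := hcut (insert (o s) T) (insert_nonempty _ _) (nonempty_compl.2 fun huniv => by
      have := ncard_insert_le (o s) T
      rw [huniv, ncard_univ] at this
      omega)
    omega
  · rw [Subtype.ext_iff]
    exact ⟨fun h => (ho t).le ⟨h, w.2⟩, fun h => h ▸ (hmem t).1⟩

end Contraction

section Generation

variable {V : Type u} {G : SimpleGraph V}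

lemma isCubic_completeGraph_four : IsCubic (⊤ : SimpleGraph (Fin 4)) := fun v => by
  rw [neighborSet_top, ncard_compl, ncard_singleton, Nat.card_fin]

lemma isThreeConnected_completeGraph_four : IsThreeConnected (⊤ : SimpleGraph (Fin 4)) := by
  refine ⟨inferInstance, by simp, fun S hS => ?_⟩
  have : Nonempty ↥Sᶜ := (nonempty_compl.2 fun h => by simp [h, ncard_univ] at hS).to_subtype
  rw [induce_top]
  exact connected_top

/-- The perfect matching `{03, 12}` of the complete graph on four vertices. -/
def reversalMatching : (⊤ : SimpleGraph (Fin 4)).Subgraph where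
  verts := univ
  Adj a b := b = a.rev
  adj_sub := by
    rintro a _ rfl
    revert a
    decide
  edge_vert _ := mem_univ _
  symm := ⟨fun a b h => by rw [h, Fin.rev_rev]⟩

lemma isUniqueMatching_reversalMatching : IsUniqueMatching reversalMatching s(0, 3) where
  isPerfectMatching := Subgraph.isPerfectMatching_iff.2 fun a => ⟨a.rev, rfl, fun _ h => h⟩
  mem_edgeSet := rfl
  eq_of_mem_edgeSet N hN (h03 : N.Adj 0 3) := by
    have h12 : N.Adj 1 2 := by
      obtain ⟨b, hb, -⟩ := Subgraph.isPerfectMatching_iff.1 hN 1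
      fin_cases b
      · exact absurd (hN.1.eq_of_adj_left h03 hb.symm) (by decide)
      · exact absurd rfl hb.ne
      · exact hb
      · exact absurd (hN.1.eq_of_adj_left h03.symm hb.symm) (by decide)
    have hrev : ∀ a : Fin 4, N.Adj a a.rev := by
      intro a
      fin_cases a
      exacts [h03, h12, h12.symm, h03.symm]
    refine Subgraph.ext hN.2.verts_eq_univ ?_
    ext a b
    exact ⟨fun h => hN.1.eq_of_adj_left h (hrev a), by rintro rfl; exact hrev a⟩

lemma inU_completeGraph_four : InU (⊤ : SimpleGraph (Fin 4)) :=
  ⟨isCubic_completeGraph_four, isThreeConnected_completeGraph_four, s(0, 3),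
    isLonely_iff.2 ⟨_, isUniqueMatching_reversalMatching⟩⟩

lemma InU.replaceByTriangle (hG : InU G) {e : Sym2 V} {v : V} (he : IsLonely G e)
    (hv : v ∈ e ∨ ¬ ∃ J : G.Subgraph, IsJoin v J ∧ e ∈ J.edgeSet) :
    InU (replaceByTriangle G v) := by
  obtain ⟨hcubic, hconn, -⟩ := hG
  have : Finite V := hconn.1
  have hnonempty : (G.neighborSet v).Nonempty := nonempty_of_ncard_ne_zero (by simp [hcubic v])
  have : Nonempty (TriangleVertex G v) := hnonempty.elim fun x hx => ⟨Sum.inr ⟨x, hx⟩⟩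
  have hcubic' := (isCubic_replaceByTriangle_iff hnonempty).2 hcubic
  have hcut := (isThreeEdgeConnected_replaceByTriangle_iff (hcubic v)).2
    (hconn.isThreeEdgeConnected hcubic)
  exact ⟨hcubic', hcut.isThreeConnected hcubic',
    hv.elim (exists_isLonely_replaceByTriangle_of_mem (hcubic v) he)
      (exists_isLonely_replaceByTriangle_of_not_exists_isJoin (hcubic v) he)⟩

theorem Generated.inU (hG : Generated G) : InU G := by
  induction hG with
  | base G iso => exact inU_completeGraph_four.of_iso iso.some.symm
  | step G e v H _ he hv iso ih => exact (ih.replaceByTriangle he hv).of_iso iso.some.symm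

lemma IsCubic.nonempty_iso_completeGraph_four (hG : IsCubic G) (hV : Nat.card V = 4) :
    Nonempty (G ≃g (⊤ : SimpleGraph (Fin 4))) := by
  have : Finite V := Nat.finite_of_card_ne_zero (by omega)
  obtain rfl : G = ⊤ := eq_top_iff_forall_ne_adj.2 fun v w hne => by
    have hall : insert v (G.neighborSet v) = univ := eq_of_subset_of_ncard_le (subset_univ _) (by
      rw [ncard_univ, hV, ncard_insert_of_notMem (by simp), hG v])
    exact (hall.ge (mem_univ w)).resolve_left hne.symm
  exact ⟨Iso.completeGraph (Finite.equivFinOfCardEq hV)⟩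

lemma card_option_compl_lt [Finite V] {T : Set V} (hT : T.ncard = 3) :
    Nat.card (Option ↥Tᶜ) < Nat.card V := by
  have := ncard_add_ncard_compl T
  rw [Finite.card_option, Nat.card_coe_set_eq]
  omega

theorem InU.exists_iso_replaceByTriangle (hG : InU G) (hV : 4 < Nat.card V) :
    ∃ (W : Type u) (H : SimpleGraph W) (e : Sym2 W) (v : W), Nat.card W < Nat.card V ∧ InU H ∧
      IsLonely H e ∧ (v ∈ e ∨ ¬ ∃ J : H.Subgraph, IsJoin v J ∧ e ∈ J.edgeSet) ∧
      Nonempty (G ≃g CubicGraph.replaceByTriangle H v) := by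
  obtain ⟨hcubic, hconn, f, hf⟩ := hG
  have : Finite V := hconn.1
  have hcut := hconn.isThreeEdgeConnected hcubic
  obtain ⟨M, hM⟩ := isLonely_iff.1 hf
  obtain ⟨a, b, c, hab, hac, hbc⟩ := hM.exists_triangle hcubic hcut
  set T : Set V := {a, b, c}
  have hT : G.IsClique T := by
    simp [T, isClique_insert, hab.adj_sub, hac, hbc]
  have hcard : T.ncard = 3 := ncard_eq_three.2 ⟨a, b, c, hab.ne, hac.ne, hbc.ne, rfl⟩
  obtain ⟨φ, hφ⟩ := hcut.exists_iso_replaceByTriangle_contract hcubic hV hT hcard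
  obtain ⟨y, hy⟩ := hφ a (.inl rfl)
  obtain ⟨z, hz⟩ := hφ b (.inr (.inl rfl))
  have hyz : (M.map φ.toHom).Adj (Sum.inr y) (Sum.inr z) := ⟨a, b, hab, hy, hz⟩
  have hnonempty : ((contract G T).neighborSet none).Nonempty := ⟨y.1, y.2⟩
  have hcubic' := (isCubic_replaceByTriangle_iff hnonempty).1 (hcubic.of_iso φ)
  have hthree : Nat.card {x // (contract G T).Adj none x} = 3 := hcubic' none
  have hcut' := (isThreeEdgeConnected_replaceByTriangle_iff hthree).1
    ((hconn.of_iso φ).isThreeEdgeConnected (hcubic.of_iso φ))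
  obtain ⟨e, he, hv⟩ :=
    exists_isLonely_of_isUniqueMatching_replaceByTriangle hthree (hM.map φ) hyz
  exact ⟨_, contract G T, e, none, card_option_compl_lt hcard,
    ⟨hcubic', hcut'.isThreeConnected hcubic', e, he⟩, he, hv, ⟨φ⟩⟩

theorem InU.generated (hG : InU G) : Generated G := by
  induction hn : Nat.card V using Nat.strong_induction_on generalizing V with
  | _ n ih =>
    rcases Nat.lt_or_ge 4 (Nat.card V) with hV | hV
    · obtain ⟨W, H, e, v, hlt, hH, he, hv, iso⟩ := hG.exists_iso_replaceByTriangle hV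
      exact .step H e v G (ih _ (hn ▸ hlt) hH rfl) he hv iso
    · exact .base G (hG.1.nonempty_iso_completeGraph_four (hV.antisymm hG.2.1.2.1))

end Generation

end CubicGraph

theorem mainTheorem4 {V : Type u} (G : SimpleGraph V) :
    CubicGraph.InU G ↔ CubicGraph.Generated G :=
  ⟨fun h => h.generated, fun h => h.inU⟩
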